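/- Let $k$ be a field, let $A$ be a finite dimensional $k$-algebra and let $e\in A$ be an idempotent. Let $I=AeA$ be the two-sided ideal spanned by the products $aeb$ with $a,b\in A$, and put $B=A/I$. Assume that multiplication in $A$ induces an isomorphism (of $A$-bimodules) $Ae\otimes_k eA\to AeA=I$. Let $D(-)=\operatorname{Hom}_k(-,k)$, so that $D(eA)$ is a left $A$-module. For a $k$-algebra $\Lambda$ put $\Lambda^e=\Lambda\otimes_k\Lambda^{\mathrm{op}}$ and $HH^p(\Lambda)=\operatorname{Ext}^p_{\Lambda^e}(\Lambda,\Lambda)$, and let $Z(\Lambda)$ be the center of $\Lambda$. Then: 1. $I$ is a homological ideal of $A$, that is, the functor $D^b(\mathrm{Mod}\,B)\to D^b(\mathrm{Mod}\,A)$ between the bounded derived categories of left modules given by restriction of scalars along the projection $A\to B$ is fully faithful. 2. There is a long exact sequence of $k$-vector spaces $$0\to Z(A)\cap I\to HH^0(A)\to HH^0(B)\to \operatorname{Ext}^1_A(D(eA),Ae)\to\cdots$$ $$\cdots\to\operatorname{Ext}^p_A(D(eA),Ae)\to HH^p(A)\to HH^p(B)\to\operatorname{Ext}^{p+1}_A(D(eA),Ae)\to\cdots$$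 in which the first map is the inclusion $Z(A)\cap I\subseteq Z(A)\cong HH^0(A)$ and the maps $HH^p(A)\to HH^p(B)$ are compatible with the projection $\phi:A\to B$: the composite of $HH^p(A)\to HH^p(B)$ with the change of rings map $HH^p(B)\to\operatorname{Ext}^p_{A^e}(A,B)$ (restriction along $A^e\to B^e$ followed by precomposition with $\phi$) is the map $HH^p(A)=\operatorname{Ext}^p_{A^e}(A,A)\to\operatorname{Ext}^p_{A^e}(A,B)$ induced by $\phi$ on coefficients. -/

import Mathlib

open CategoryTheory

open scoped TensorProduct

universe u

namespace IdempotentQuotient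

noncomputable section

/-! ### Restriction of scalars and homological ideals -/

section DerivedRestriction

variable {R S : Type u} [Ring R] [Ring S] (f : R →+* S)

instance restrictScalars_preservesFiniteLimits :
    Limits.PreservesFiniteLimits (ModuleCat.restrictScalars.{u} f) := by
  have := ((Functor.exact_tfae (ModuleCat.restrictScalars.{u} f)).out 1 3).mp (by
    intro T hT
    rw [ShortComplex.ShortExact.moduleCat_exact_iff_function_exact] at hT ⊢
    exact hT)
  exact this.1

instance restrictScalars_preservesFiniteColimits :
    Limits.PreservesFiniteColimits (ModuleCat.restrictScalars.{u} f) := by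
  have := ((Functor.exact_tfae (ModuleCat.restrictScalars.{u} f)).out 1 3).mp (by
    intro T hT
    rw [ShortComplex.ShortExact.moduleCat_exact_iff_function_exact] at hT ⊢
    exact hT)
  exact this.2

attribute [local instance] HasDerivedCategory.standard

/-- The functor `D(S) ⥤ D(R)` induced by restriction of scalars sends bounded objects to
bounded objects. -/
theorem mapDerivedCategory_bounded (X : DerivedCategory.Bounded (ModuleCat.{u} S)) :
    (DerivedCategory.TStructure.t (C := ModuleCat.{u} R)).bounded
      ((DerivedCategory.Bounded.ι ⋙
        (ModuleCat.restrictScalars.{u} f).mapDerivedCategory).obj X) := by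
  obtain ⟨X, ⟨a, ⟨K, eK, hK⟩⟩, ⟨b, ⟨L, eL, hL⟩⟩⟩ := X
  refine ⟨⟨a, ⟨⟨_, (ModuleCat.restrictScalars.{u} f).mapDerivedCategory.mapIso eK ≪≫
      (ModuleCat.restrictScalars.{u} f).mapDerivedCategoryFactors.app K, ?_⟩⟩⟩,
    ⟨b, ⟨⟨_, (ModuleCat.restrictScalars.{u} f).mapDerivedCategory.mapIso eL ≪≫
      (ModuleCat.restrictScalars.{u} f).mapDerivedCategoryFactors.app L, ?_⟩⟩⟩⟩
  · change CochainComplex.IsStrictlyGE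
      (((ModuleCat.restrictScalars.{u} f).mapHomologicalComplex (ComplexShape.up ℤ)).obj K) a
    infer_instance
  · change CochainComplex.IsStrictlyLE
      (((ModuleCat.restrictScalars.{u} f).mapHomologicalComplex (ComplexShape.up ℤ)).obj L) b
    infer_instance

/-- The functor `D^b(Mod S) ⥤ D^b(Mod R)` between bounded derived categories of left modules
induced by restriction of scalars along `f : R → S`. -/
def boundedDerivedRestriction :
    DerivedCategory.Bounded (ModuleCat.{u} S) ⥤ DerivedCategory.Bounded (ModuleCat.{u} R) :=
  (DerivedCategory.TStructure.t (C := ModuleCat.{u} R)).bounded.lift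
    (DerivedCategory.Bounded.ι ⋙ (ModuleCat.restrictScalars.{u} f).mapDerivedCategory)
    (mapDerivedCategory_bounded f)

/-- `f : R → S` is a homological epimorphism: `D^b(Mod S) ⥤ D^b(Mod R)` is fully faithful. -/
def IsHomologicalEpi : Prop :=
  (boundedDerivedRestriction f).Full ∧ (boundedDerivedRestriction f).Faithful

/-- A two-sided ideal `I` of `R` is homological if `R → R ⧸ I` is a homological epimorphism. -/
def IsHomologicalIdeal (I : Ideal R) [I.IsTwoSided] : Prop :=
  IsHomologicalEpi (Ideal.Quotient.mk I)

end DerivedRestriction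

/-! ### Hochschild cohomology -/

section Hochschild

variable (k : Type u) [Field k] (A : Type u) [Ring A] [Algebra k A]

/-- The enveloping algebra `A ⊗ Aᵒᵖ`. -/
abbrev Env : Type u := A ⊗[k] Aᵐᵒᵖ

/-- The regular bimodule `A`, as a left module over the enveloping algebra:
`(a ⊗ b) • x = a * x * b`. -/
def regBimodule : ModuleCat.{u} (Env k A) :=
  letI : Module (Env k A) A := TensorProduct.Algebra.module
  ModuleCat.of (Env k A) A

/-- An element of `A` as an element of the regular bimodule. -/
def toReg (a : A) : regBimodule k A := a

/-- An element of the regular bimodule as an element of `A`. -/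
def ofReg (x : regBimodule k A) : A := x

/-- The Hochschild cohomology `HH^n(A) = Ext^n_{A ⊗ Aᵒᵖ}(A, A)`. -/
abbrev HH (n : ℕ) : Type u :=
  Abelian.Ext.{u} (regBimodule k A) (regBimodule k A) n

variable {k A} {B : Type u} [Ring B] [Algebra k B] (φ : A →ₐ[k] B)

/-- The map of enveloping algebras induced by `φ : A → B`. -/
def envMap : Env k A →+* Env k B :=
  (Algebra.TensorProduct.map φ (AlgHom.op φ)).toRingHom

/-- The bimodule `B`, seen as an `A`-bimodule by restriction along `φ : A → B`. -/
abbrev regRestrict : ModuleCat.{u} (Env k A) :=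
  (ModuleCat.restrictScalars.{u} (envMap φ)).obj (regBimodule k B)

theorem map_smul_env (r : Env k A) (a : A) :
    φ (TensorProduct.Algebra.moduleAux r a) =
      TensorProduct.Algebra.moduleAux (envMap φ r) (φ a) := by
  induction r using TensorProduct.induction_on with
  | zero => simp
  | tmul x y =>
    have h : envMap φ (x ⊗ₜ[k] y) = φ x ⊗ₜ[k] AlgHom.op φ y := rfl
    rw [h]
    simp [TensorProduct.Algebra.moduleAux_apply, MulOpposite.smul_eq_mul_unop]
  | add x y hx hy => simp [hx, hy]

/-- The map `φ : A → B`, as a morphism of `A`-bimodules. -/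
def regMap : regBimodule k A ⟶ regRestrict φ :=
  ModuleCat.ofHom (X := regBimodule k A) (Y := regRestrict φ)
    { toFun := fun a => toReg k B (φ (ofReg k A a))
      map_add' := fun a b => map_add φ (ofReg k A a) (ofReg k A b)
      map_smul' := fun r a => map_smul_env φ r (ofReg k A a) }

/-- The map `φ_* : HH^n(A) = Ext^n_{A^e}(A, A) → Ext^n_{A^e}(A, B)` induced by `φ : A → B`
on coefficients. -/
def hhPush {n : ℕ} (x : HH k A n) : Abelian.Ext.{u} (regBimodule k A) (regRestrict φ) n :=
  x.comp (Abelian.Ext.mk₀ (regMap φ)) (add_zero n)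

/-- The change of rings map `HH^n(B) = Ext^n_{B^e}(B, B) → Ext^n_{A^e}(A, B)`: restriction
of scalars to `Ext^n_{A^e}(B, B)` followed by precomposition with `φ : A → B`. -/
def hhPull {n : ℕ} (y : HH k B n) : Abelian.Ext.{u} (regBimodule k A) (regRestrict φ) n :=
  (Abelian.Ext.mk₀ (regMap φ)).comp
    (y.mapExactFunctor (ModuleCat.restrictScalars.{u} (envMap φ))) (zero_add n)

end Hochschild

/-! ### The modules `Ae`, `eA`, `D(eA)` and the ideal `AeA` -/

section Idempotent

variable {A : Type u} [Ring A]

/-- The left ideal `Ae`. -/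
abbrev leftPart (e : A) : Ideal A := Submodule.span A {e}

/-- The right ideal `eA`, as a module over `Aᵐᵒᵖ`. -/
abbrev rightPart (e : A) : Submodule Aᵐᵒᵖ A := Submodule.span Aᵐᵒᵖ {e}

/-- The two-sided ideal `AeA`, spanned by the products `a * e * b`. -/
def AeA (e : A) : Ideal A := Ideal.span {x | ∃ a b : A, x = a * e * b}

instance (e : A) : (AeA e).IsTwoSided where
  mul_mem_of_left := by
    intro x c hx
    induction hx using Submodule.span_induction with
    | mem x hx =>
      obtain ⟨a, b, rfl⟩ := hx
      exact Ideal.subset_span ⟨a, b * c, by rw [mul_assoc]⟩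
    | zero => rw [zero_mul]; exact (AeA e).zero_mem
    | add x y _ _ hx hy => rw [add_mul]; exact (AeA e).add_mem hx hy
    | smul r x _ hx => rw [smul_eq_mul, mul_assoc]; exact (AeA e).mul_mem_left r hx

theorem mul_mem_AeA {e x y : A} (he : IsIdempotentElem e)
    (hx : x ∈ leftPart e) (hy : y ∈ rightPart e) :
    x * y ∈ AeA e := by
  obtain ⟨a, rfl⟩ := Submodule.mem_span_singleton.mp hx
  obtain ⟨b, rfl⟩ := Submodule.mem_span_singleton.mp hy
  refine Ideal.subset_span ⟨a, b.unop, ?_⟩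
  rw [MulOpposite.smul_eq_mul_unop, smul_eq_mul, ← mul_assoc, mul_assoc a e e, he.eq]

variable (k : Type u) [Field k] [Algebra k A]

/-- The multiplication map `Ae ⊗ eA → AeA`, `x ⊗ y ↦ x * y`, the tensor product being
over `k`. -/
def mulMap (e : A) (he : IsIdempotentElem e) :
    (leftPart e) ⊗[k] (rightPart e) →ₗ[k] AeA e :=
  TensorProduct.lift
    (LinearMap.mk₂ k (fun x y => ⟨x.1 * y.1, mul_mem_AeA he x.2 y.2⟩)
      (fun x x' y => Subtype.ext (add_mul x.1 x'.1 y.1))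
      (fun c x y => Subtype.ext (smul_mul_assoc c x.1 y.1))
      (fun x y y' => Subtype.ext (mul_add x.1 y.1 y'.1))
      (fun c x y => Subtype.ext (mul_smul_comm c x.1 y.1)))

/-- The dual `D(N) = Hom_k(N, k)` of a right `A`-module `N`. -/
def RightDual (A : Type u) [Ring A] [Algebra k A] (N : Type u) [AddCommGroup N] [Module k N]
    [Module Aᵐᵒᵖ N] [IsScalarTower k Aᵐᵒᵖ N] : Type u := N →ₗ[k] k

section RightDual

variable (A) (N : Type u) [AddCommGroup N] [Module k N] [Module Aᵐᵒᵖ N] [IsScalarTower k Aᵐᵒᵖ N]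

instance : AddCommGroup (RightDual k A N) := inferInstanceAs (AddCommGroup (N →ₗ[k] k))

/-- The left `A`-module structure of `D(N)`: `(a • f) x = f (x · a)`. -/
instance : Module A (RightDual k A N) where
  smul a f := LinearMap.comp (show N →ₗ[k] k from f) (Algebra.lsmul k k N (MulOpposite.op a))
  one_smul f := LinearMap.ext fun x =>
    congrArg (show N →ₗ[k] k from f) (one_smul Aᵐᵒᵖ x)
  mul_smul a b f := LinearMap.ext fun x =>
    congrArg (show N →ₗ[k] k from f) (mul_smul (MulOpposite.op b) (MulOpposite.op a) x)
  smul_zero _ := rfl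
  smul_add _ _ _ := rfl
  add_smul a b f := LinearMap.ext fun x =>
    (congrArg (show N →ₗ[k] k from f) (add_smul (MulOpposite.op a) (MulOpposite.op b) x)).trans
      (map_add (show N →ₗ[k] k from f) _ _)
  zero_smul f := LinearMap.ext fun x =>
    (congrArg (show N →ₗ[k] k from f) (zero_smul Aᵐᵒᵖ x)).trans
      (map_zero (show N →ₗ[k] k from f))

end RightDual

/-- `Ext^n_A(D(eA), Ae)`, in the category of left `A`-modules. -/
abbrev ExtDual (e : A) (n : ℕ) : Type u :=
  Abelian.Ext.{u} (ModuleCat.of.{u} A (RightDual k A (rightPart e)))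
    (ModuleCat.of.{u} A (leftPart e)) n

/-- `Z(A) ∩ I`, for an ideal `I`, as a `k`-subspace of `A`. -/
abbrev centerInter (I : Ideal A) : Submodule k A :=
  Subalgebra.toSubmodule (Subalgebra.center k A) ⊓ I.restrictScalars k

end Idempotent

end

end IdempotentQuotient

/-!
The sequence is the long exact sequence of `Ext_{A^e}(A, -)` attached to `0 → I → A → B → 0`, where
`I = AeA` and `B = A ⧸ I`, with its terms for `I` and `B` identified.

*The term for `I`.* Since `A` is finite dimensional, `I ≅ Ae ⊗ eA ≅ Hom_k(D(eA), Ae)` as bimodules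
(`mulShortComplex_shortExact`), and `Ext_{A^e}(A, Hom_k(M, N)) = Ext_A(M, N)` for all left modules
`M` and `N` (`extHomEquiv`). In degree `0` the image of `Hom_{A^e}(A, I)` in `Hom_{A^e}(A, A)` is
`Z(A) ∩ I` (`comp_regMap_eq_zero_iff`).

*The term for `B`.* Restriction along `A → B` induces bijections `Ext_B(M, N) → Ext_A(M, N)`
(`resFunctor_ext_bijective`) and `HH(B) → Ext_{A^e}(A, B)` (`hhPull_bijective`); the map
`HH(A) → HH(B)` is the one induced by `A → B` on coefficients, followed by the inverse of the second
of these. The first bijection also gives that `I` is homological: a bounded complex is built from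
modules placed in one degree by extensions, so an exact functor which is bijective on all `Ext`
groups is fully faithful on bounded derived categories (`isMapBijective_of_bounded`).

All three comparisons of `Ext` groups have the same shape: an exact functor `F` and a morphism
`t : a ⟶ F M` induce maps `Ext(M, N) → Ext(a, F N)`. By dimension shifting, they are bijective in
all degrees as soon as they are so in degree `0` and every `N` embeds in an object on which both
sides vanish in positive degrees (`extTransfer_bijective`). The embeddings used here are those into
coinduced modules `Hom_k(R, V)` and bimodules `Hom_k(M, Hom_k(R, V))`, and the vanishing statements
are as follows.

* `Hom_k(R, V)` is an injective `R`-module, and `Hom_k(M, Hom_k(R, V))` is acyclic for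
  `Ext_{R^e}(R, -)` (`subsingleton_ext_hom_coind`): it is an injective bimodule if `M` is
  projective, and the general case follows by dimension shifting in `M`.
* `Hom_k(B, V)` is acyclic for `Ext_A(M, -)` if `M` is a `B`-module (`subsingleton_ext_res_coind`).
  This is where the hypothesis on `Ae ⊗ eA` enters: the dual
  `0 → Hom_k(B, V) → Hom_k(A, V) → Hom_k(Ae ⊗ eA, V) → 0` of the sequence above is an injective
  resolution over `A`, since `Hom_k(Ae ⊗ eA, V) = Hom_k(eA, Hom_k(Ae, V))` is a direct summand of a
  module coinduced from `k`; and there are no nonzero maps from `M` to its last term, as `AeA`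
  kills `M`.
-/

namespace CategoryTheory

open Limits Pretriangulated Triangulated

/-! ### Comparing `Ext` groups along an exact functor -/

section Ext

universe w w' v v' u'

open Abelian

variable {C : Type u} [Category.{v} C] [Abelian C] [HasExt.{w} C]
  {D : Type u'} [Category.{v'} D] [Abelian D] [HasExt.{w'} D]

/-- For an exact functor `F` and a morphism `t : a ⟶ F.obj M`, the map
`Ext^n(M, N) → Ext^n(a, F N)` which applies `F` and then precomposes with `t`. -/
noncomputable def extTransfer (F : C ⥤ D) [F.Additive] [PreservesFiniteLimits F]
    [PreservesFiniteColimits F] {a : D} {M : C} (t : a ⟶ F.obj M) (N : C) (n : ℕ) :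
    Ext.{w} M N n →+ Ext.{w'} a (F.obj N) n :=
  ((Ext.mk₀ t).precomp (F.obj N) (zero_add n)).comp (F.mapExtAddHom M N n)

theorem extTransfer_apply (F : C ⥤ D) [F.Additive] [PreservesFiniteLimits F]
    [PreservesFiniteColimits F] {a : D} {M : C} (t : a ⟶ F.obj M) {N : C} {n : ℕ}
    (x : Ext.{w} M N n) :
    extTransfer F t N n x = (Ext.mk₀ t).comp (x.mapExactFunctor F) (zero_add n) := rfl

/-- Both sides of `extTransfer` are cohomological functors of `N`; if they agree in degree `0`
and vanish in positive degrees on enough objects, dimension shifting makes them agree in all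
degrees. -/
theorem extTransfer_bijective (F : C ⥤ D) [F.Additive] [PreservesFiniteLimits F]
    [PreservesFiniteColimits F] {a : D} {M : C} (t : a ⟶ F.obj M)
    (h₀ : ∀ N : C, Function.Bijective (fun f : M ⟶ N => t ≫ F.map f))
    (heff : ∀ N : C, ∃ (E : C) (i : N ⟶ E), Mono i ∧
      (∀ n, Subsingleton (Ext.{w} M E (n + 1))) ∧
      ∀ n, Subsingleton (Ext.{w'} a (F.obj E) (n + 1))) (N : C) (n : ℕ) :
    Function.Bijective (extTransfer F t N n) := by
  induction n generalizing N with
  | zero =>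
    have h : ⇑(extTransfer F t N 0) =
        Ext.addEquiv₀.symm ∘ (fun f : M ⟶ N => t ≫ F.map f) ∘ Ext.addEquiv₀ := by
      ext x
      obtain ⟨y, rfl⟩ := Ext.addEquiv₀.symm.surjective x
      simp [extTransfer_apply, Ext.addEquiv₀, Ext.homEquiv₀, Ext.mapExactFunctor_mk₀]
    rw [h]
    exact Ext.addEquiv₀.symm.bijective.comp ((h₀ N).comp Ext.addEquiv₀.bijective)
  | succ n hn =>
    obtain ⟨E, i, hi, hE, hE'⟩ := heff N
    let S := ShortComplex.mk _ _ (cokernel.condition i)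
    have hS : S.ShortExact := { exact := ShortComplex.exact_cokernel i }
    have := hE n
    have := hE' n
    exact AddMonoidHom.bijective_of_surjective_of_bijective_of_right_exact _ _ _ _
      (extTransfer F t S.X₂ n) (extTransfer F t S.X₃ n) (extTransfer F t S.X₁ (n + 1))
      (by
        ext x
        refine Eq.trans ?_ (congrArg ((Ext.mk₀ t).comp · (zero_add n))
          ((Ext.mapExactFunctor_comp F x (Ext.mk₀ S.g) (add_zero n)).trans
            (by rw [Ext.mapExactFunctor_mk₀]))).symm
        exact Ext.comp_assoc_of_third_deg_zero _ _ _ _)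
      (by
        ext x
        refine Eq.trans ?_ (congrArg ((Ext.mk₀ t).comp · (zero_add (n + 1)))
          ((Ext.mapExactFunctor_comp F x hS.extClass rfl).trans
            (by rw [Ext.mapExactFunctor_extClass]))).symm
        exact Ext.comp_assoc _ _ _ (zero_add n) rfl (by omega))
      ((ShortComplex.ab_exact_iff_function_exact _).mp
        (Ext.covariant_sequence_exact₃' M hS n (n + 1) rfl))
      ((ShortComplex.ab_exact_iff_function_exact _).mp
        (Ext.covariant_sequence_exact₃' a (hS.map F) n (n + 1) rfl))
      (hn _).surjective (hn _)
      (fun x₁ ↦ Ext.covariant_sequence_exact₁ _ hS x₁ (Subsingleton.elim (α := Ext M E _) _ _) rfl)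
      (fun y₁ ↦ Ext.covariant_sequence_exact₁ _ (hS.map F) y₁
        (Subsingleton.elim (α := Ext a (F.obj E) _) _ _) rfl)

theorem extTransfer_smul (R : Type*) [Ring R] [Linear R C] [Linear R D] (F : C ⥤ D) [F.Additive]
    [F.Linear R] [PreservesFiniteLimits F] [PreservesFiniteColimits F] {a : D} {M : C}
    (t : a ⟶ F.obj M) {N : C} {n : ℕ} (r : R) (x : Ext.{w} M N n) :
    extTransfer F t N n (r • x) = r • extTransfer F t N n x := by
  simp [extTransfer_apply]

/-- Dimension shifting in degree one: `Ext^1(X, S₁)` vanishes if `Ext^1(X, S₂)` does and all maps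
from `X` lift along `S₂ → S₃`. -/
theorem subsingleton_ext_one_of_lift {X : C} {S : ShortComplex C} (hS : S.ShortExact)
    (h₂ : Subsingleton (Ext.{w} X S.X₂ 1)) (h : ∀ f : X ⟶ S.X₃, ∃ g, g ≫ S.g = f) :
    Subsingleton (Ext.{w} X S.X₁ 1) := by
  refine subsingleton_of_forall_eq 0 fun x => ?_
  obtain ⟨y, rfl⟩ := Ext.covariant_sequence_exact₁ _ hS x (h₂.elim _ _) (zero_add 1)
  obtain ⟨f, rfl⟩ := Ext.addEquiv₀.symm.surjective y
  obtain ⟨g, rfl⟩ := h f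
  change (Ext.mk₀ (g ≫ S.g)).comp hS.extClass _ = 0
  rw [← Ext.mk₀_comp_mk₀, Ext.comp_assoc _ _ _ (add_zero 0) (zero_add 1) (by omega),
    hS.comp_extClass, Ext.comp_zero]

/-- Dimension shifting in higher degrees. -/
theorem subsingleton_ext_succ {X : C} {S : ShortComplex C} (hS : S.ShortExact) {n : ℕ}
    (h₂ : Subsingleton (Ext.{w} X S.X₂ (n + 1))) (h₃ : Subsingleton (Ext.{w} X S.X₃ n)) :
    Subsingleton (Ext.{w} X S.X₁ (n + 1)) := by
  refine subsingleton_of_forall_eq 0 fun x => ?_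
  obtain ⟨y, rfl⟩ := Ext.covariant_sequence_exact₁ _ hS x (h₂.elim _ _) rfl
  rw [h₃.elim y 0, Ext.zero_comp]

end Ext

/-! ### Full faithfulness on bounded derived categories -/

section Devissage

section

variable {T T' : Type*} [Category* T] [Category* T'] (F : T ⥤ T')

/-- `F` is bijective on morphisms from `X` to `Y`. -/
def IsMapBijective (X Y : T) : Prop := Function.Bijective (F.map : (X ⟶ Y) → _)

variable {F}

theorem IsMapBijective.of_iso {X X' Y Y' : T} (e : X ≅ X') (e' : Y ≅ Y')
    (h : IsMapBijective F X Y) : IsMapBijective F X' Y' := by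
  have : (F.map : (X' ⟶ Y') → _) =
      (F.mapIso e).homCongr (F.mapIso e') ∘ F.map ∘ (e.homCongr e').symm := by
    ext f
    simp
  rw [IsMapBijective, this]
  exact (Equiv.bijective _).comp (h.comp (Equiv.bijective _))

theorem IsMapBijective.shift [HasShift T ℤ] [HasShift T' ℤ] [F.CommShift ℤ] {X Y : T}
    (h : IsMapBijective F X Y) (n : ℤ) : IsMapBijective F (X⟦n⟧) (Y⟦n⟧) := by
  have h2 : (F.map : (X⟦n⟧ ⟶ Y⟦n⟧) → _) ∘ (shiftFunctor T n).map =
      ((F.commShiftIso n).app X).symm.homCongr ((F.commShiftIso n).app Y).symm ∘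
        (shiftFunctor T' n).map ∘ F.map := by
    ext f
    simp [Iso.homCongr]
  have h3 := (Functor.FullyFaithful.ofFullyFaithful (shiftFunctor T n)).map_bijective X Y
  rw [IsMapBijective, ← Function.Bijective.of_comp_iff _ h3, h2]
  exact (Equiv.bijective _).comp
    (((Functor.FullyFaithful.ofFullyFaithful (shiftFunctor T' n)).map_bijective _ _).comp h)

variable [Preadditive T] [Preadditive T'] [F.Additive]

/-- The five lemma for `Hom(X, -)`, applied to `Y₀ ⟶ Y₁ ⟶ Y₂ ⟶ Y₃ ⟶ Y₄`. -/
theorem IsMapBijective.five_right {X Y₀ Y₁ Y₂ Y₃ Y₄ : T} {m₀ : Y₀ ⟶ Y₁} {m₁ : Y₁ ⟶ Y₂}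
    {m₂ : Y₂ ⟶ Y₃} {m₃ : Y₃ ⟶ Y₄} (z₁ : m₀ ≫ m₁ = 0) (z₃ : m₂ ≫ m₃ = 0)
    (e₂ : ∀ f : X ⟶ Y₂, f ≫ m₂ = 0 → ∃ g, f = g ≫ m₁)
    (e₃ : ∀ f : X ⟶ Y₃, f ≫ m₃ = 0 → ∃ g, f = g ≫ m₂)
    (e₁' : ∀ f : F.obj X ⟶ F.obj Y₁, f ≫ F.map m₁ = 0 → ∃ g, f = g ≫ F.map m₀)
    (e₂' : ∀ f : F.obj X ⟶ F.obj Y₂, f ≫ F.map m₂ = 0 → ∃ g, f = g ≫ F.map m₁)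
    (h₀ : IsMapBijective F X Y₀) (h₁ : IsMapBijective F X Y₁)
    (h₃ : IsMapBijective F X Y₃) (h₄ : IsMapBijective F X Y₄) : IsMapBijective F X Y₂ := by
  constructor
  · refine (injective_iff_map_eq_zero (F.mapAddHom (X := X) (Y := Y₂))).2 fun f hf => ?_
    replace hf : F.map f = 0 := hf
    obtain ⟨g, rfl⟩ := e₂ f (h₃.1 (by simp [hf]))
    obtain ⟨h, hh⟩ := e₁' (F.map g) (by simpa using hf)
    obtain ⟨h, rfl⟩ := h₀.2 h
    obtain rfl : g = h ≫ m₀ := h₁.1 (by rw [hh, F.map_comp])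
    rw [Category.assoc, z₁, comp_zero]
  · intro f
    obtain ⟨g, hg⟩ := h₃.2 (f ≫ F.map m₂)
    obtain ⟨g', rfl⟩ := e₃ g (h₄.1 (by
      rw [F.map_comp, hg, Category.assoc, ← F.map_comp, z₃, F.map_zero, comp_zero, F.map_zero]))
    obtain ⟨h, hh⟩ := e₂' (f - F.map g') (by
      rw [Preadditive.sub_comp, ← F.map_comp, hg, sub_self])
    obtain ⟨h, rfl⟩ := h₁.2 h
    exact ⟨g' + h ≫ m₁, by rw [F.map_add, F.map_comp, ← hh, add_sub_cancel]⟩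

/-- The five lemma for `Hom(-, Y)`, applied to `X₀ ⟶ X₁ ⟶ X₂ ⟶ X₃ ⟶ X₄`. -/
theorem IsMapBijective.five_left {Y X₀ X₁ X₂ X₃ X₄ : T} {m₀ : X₀ ⟶ X₁} {m₁ : X₁ ⟶ X₂}
    {m₂ : X₂ ⟶ X₃} {m₃ : X₃ ⟶ X₄} (z₁ : m₀ ≫ m₁ = 0) (z₃ : m₂ ≫ m₃ = 0)
    (e₂ : ∀ f : X₂ ⟶ Y, m₁ ≫ f = 0 → ∃ g, f = m₂ ≫ g)
    (e₁ : ∀ f : X₁ ⟶ Y, m₀ ≫ f = 0 → ∃ g, f = m₁ ≫ g)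
    (e₃' : ∀ f : F.obj X₃ ⟶ F.obj Y, F.map m₂ ≫ f = 0 → ∃ g, f = F.map m₃ ≫ g)
    (e₂' : ∀ f : F.obj X₂ ⟶ F.obj Y, F.map m₁ ≫ f = 0 → ∃ g, f = F.map m₂ ≫ g)
    (h₀ : IsMapBijective F X₀ Y) (h₁ : IsMapBijective F X₁ Y)
    (h₃ : IsMapBijective F X₃ Y) (h₄ : IsMapBijective F X₄ Y) : IsMapBijective F X₂ Y := by
  constructor
  · refine (injective_iff_map_eq_zero (F.mapAddHom (X := X₂) (Y := Y))).2 fun f hf => ?_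
    replace hf : F.map f = 0 := hf
    obtain ⟨g, rfl⟩ := e₂ f (h₁.1 (by simp [hf]))
    obtain ⟨h, hh⟩ := e₃' (F.map g) (by simpa using hf)
    obtain ⟨h, rfl⟩ := h₄.2 h
    obtain rfl : g = m₃ ≫ h := h₃.1 (by rw [hh, F.map_comp])
    rw [← Category.assoc, z₃, zero_comp]
  · intro f
    obtain ⟨g, hg⟩ := h₁.2 (F.map m₁ ≫ f)
    obtain ⟨g', rfl⟩ := e₁ g (h₀.1 (by
      rw [F.map_comp, hg, ← Category.assoc, ← F.map_comp, z₁, F.map_zero, zero_comp, F.map_zero]))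
    obtain ⟨h, hh⟩ := e₂' (f - F.map g') (by
      rw [Preadditive.comp_sub, ← F.map_comp, hg, sub_self])
    obtain ⟨h, rfl⟩ := h₃.2 h
    exact ⟨g' + m₂ ≫ h, by rw [F.map_add, F.map_comp, ← hh, add_sub_cancel]⟩

end

variable {T T' : Type*} [Category* T] [Category* T'] [HasZeroObject T] [HasZeroObject T']
  [Preadditive T] [Preadditive T'] [HasShift T ℤ] [HasShift T' ℤ]
  [∀ n : ℤ, (shiftFunctor T n).Additive] [∀ n : ℤ, (shiftFunctor T' n).Additive]
  [Pretriangulated T] [Pretriangulated T'] {F : T ⥤ T'} [F.CommShift ℤ] [F.IsTriangulated]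

theorem IsMapBijective.of_triangle_right {X : T} {Δ : Triangle T} (hΔ : Δ ∈ distTriang T)
    (h₀ : IsMapBijective F X (Δ.obj₃⟦(-1 : ℤ)⟧)) (h₁ : IsMapBijective F X Δ.obj₁)
    (h₃ : IsMapBijective F X Δ.obj₃) (h₄ : IsMapBijective F X (Δ.obj₁⟦(1 : ℤ)⟧)) :
    IsMapBijective F X Δ.obj₂ :=
  IsMapBijective.five_right (m₀ := Δ.invRotate.mor₁)
    (comp_distTriang_mor_zero₁₂ _ (inv_rot_of_distTriang _ hΔ))
    (comp_distTriang_mor_zero₂₃ _ hΔ)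
    (Triangle.coyoneda_exact₂ _ hΔ) (Triangle.coyoneda_exact₃ _ hΔ)
    (Triangle.coyoneda_exact₂ _ (F.map_distinguished _ (inv_rot_of_distTriang _ hΔ)))
    (Triangle.coyoneda_exact₂ _ (F.map_distinguished _ hΔ)) h₀ h₁ h₃ h₄

theorem IsMapBijective.of_triangle_left {Y : T} {Δ : Triangle T} (hΔ : Δ ∈ distTriang T)
    (h₀ : IsMapBijective F (Δ.obj₃⟦(-1 : ℤ)⟧) Y) (h₁ : IsMapBijective F Δ.obj₁ Y)
    (h₃ : IsMapBijective F Δ.obj₃ Y) (h₄ : IsMapBijective F (Δ.obj₁⟦(1 : ℤ)⟧) Y) :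
    IsMapBijective F Δ.obj₂ Y :=
  IsMapBijective.five_left (m₀ := Δ.invRotate.mor₁) (m₃ := Δ.mor₃)
    (comp_distTriang_mor_zero₁₂ _ (inv_rot_of_distTriang _ hΔ))
    (comp_distTriang_mor_zero₂₃ _ hΔ)
    (Triangle.yoneda_exact₂ _ hΔ)
    (Triangle.yoneda_exact₂ _ (inv_rot_of_distTriang _ hΔ))
    (Triangle.yoneda_exact₂ _ (F.map_distinguished _ (rot_of_distTriang _ hΔ)))
    (Triangle.yoneda_exact₂ _ (F.map_distinguished _ hΔ)) h₀ h₁ h₃ h₄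

end Devissage

section Bounded

universe w w' v v' w₁ w₂ u'

open Abelian

/-- An object property of a derived category which is closed under extensions and holds for the
objects concentrated in one degree holds for all bounded objects. -/
theorem bounded_induction {C : Type u} [Category.{v} C] [Abelian C] [HasDerivedCategory.{w} C]
    (P : ObjectProperty (DerivedCategory C)) [P.IsClosedUnderIsomorphisms]
    (hsingle : ∀ (M : C) (n : ℤ), P ((DerivedCategory.singleFunctor C n).obj M))
    (hext : ∀ Δ ∈ distTriang (DerivedCategory C), P Δ.obj₁ → P Δ.obj₃ → P Δ.obj₂)
    {X : DerivedCategory C} (hX : (DerivedCategory.TStructure.t (C := C)).bounded X) : P X := by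
  obtain ⟨⟨a, ha⟩, ⟨b, hb⟩⟩ := hX
  obtain ⟨d, hd⟩ : ∃ d : ℕ, b ≤ a + d := ⟨(b - a).toNat, by omega⟩
  induction d generalizing X b with
  | zero =>
    have : X.IsLE a := DerivedCategory.TStructure.t.isLE_of_le X b a (by simpa using hd)
    obtain ⟨M, ⟨e⟩⟩ := DerivedCategory.exists_iso_singleFunctor_obj_of_isGE_of_isLE X a
    exact P.prop_of_iso e.symm (hsingle M a)
  | succ d ih =>
    have : X.IsLE (a + d + 1) :=
      DerivedCategory.TStructure.t.isLE_of_le X b (a + d + 1) (by push_cast at hd; omega)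
    refine hext _ (DerivedCategory.TStructure.t.triangleLTGE_distinguished (a + d + 1) X) ?_ ?_
    · exact ih (X := (DerivedCategory.TStructure.t.truncLT (a + d + 1)).obj X) inferInstance
        (a + d) inferInstance le_rfl
    · obtain ⟨M, ⟨e⟩⟩ := DerivedCategory.exists_iso_singleFunctor_obj_of_isGE_of_isLE
        ((DerivedCategory.TStructure.t.truncGE (a + d + 1)).obj X) (a + d + 1)
      exact P.prop_of_iso e.symm (hsingle M _)

/-- An object placed in degree `m`, shifted by `n`, is the shift by `n - m` of the object placed in
degree `0`. -/
noncomputable def singleFunctorShiftIso {C : Type u} [Category.{v} C] [Abelian C]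
    [HasDerivedCategory.{w} C] (M : C) (m n : ℤ) :
    ((DerivedCategory.singleFunctor C 0).obj M)⟦n - m⟧ ≅
      ((DerivedCategory.singleFunctor C m).obj M)⟦n⟧ :=
  ((DerivedCategory.singleFunctors C).shiftIso (n - m) (m - n) 0 (by omega)).app M ≪≫
    (((DerivedCategory.singleFunctors C).shiftIso n (m - n) m (by omega)).app M).symm

variable {C : Type u} [Category.{v} C] [Abelian C] [HasDerivedCategory.{w₁} C] [HasExt.{w} C]
  {D : Type u'} [Category.{v'} D] [Abelian D] [HasDerivedCategory.{w₂} D] [HasExt.{w'} D]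
  (F : C ⥤ D) [F.Additive] [PreservesFiniteLimits F] [PreservesFiniteColimits F]

/-- Between objects in degree `0` and their shifts, the derived functor is given by the maps on
`Ext` groups (and there are no morphisms to negative shifts). -/
theorem isMapBijective_single (h : ∀ (M N : C) (n : ℕ), Function.Bijective (F.mapExtAddHom M N n))
    (M N : C) (n : ℤ) :
    IsMapBijective F.mapDerivedCategory ((DerivedCategory.singleFunctor C 0).obj M)
      (((DerivedCategory.singleFunctor C 0).obj N)⟦n⟧) := by
  let eM := (F.mapDerivedCategorySingleFunctor 0).app M
  let eN := (F.mapDerivedCategorySingleFunctor 0).app N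
  obtain hn | hn := lt_or_ge n 0
  · have h₁ : Subsingleton ((DerivedCategory.singleFunctor C 0).obj M ⟶
        ((DerivedCategory.singleFunctor C 0).obj N)⟦n⟧) := subsingleton_of_forall_eq 0 fun f => by
      have := DerivedCategory.TStructure.t.isGE_shift
        ((DerivedCategory.singleFunctor C 0).obj N) 0 n (-n)
      exact DerivedCategory.TStructure.t.zero f 0 (-n)
    have h₂ : Subsingleton (F.mapDerivedCategory.obj ((DerivedCategory.singleFunctor C 0).obj M) ⟶
        F.mapDerivedCategory.obj (((DerivedCategory.singleFunctor C 0).obj N)⟦n⟧)) := by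
      refine (eM.homCongr ((F.mapDerivedCategory.commShiftIso n).app _ ≪≫
        (shiftFunctor _ n).mapIso eN)).subsingleton_congr.2
          (subsingleton_of_forall_eq 0 fun f => ?_)
      have := DerivedCategory.TStructure.t.isGE_shift
        ((DerivedCategory.singleFunctor D 0).obj (F.obj N)) 0 n (-n)
      exact DerivedCategory.TStructure.t.zero
        (X := (DerivedCategory.singleFunctor D 0).obj (F.obj M))
        (Y := ((DerivedCategory.singleFunctor D 0).obj (F.obj N))⟦n⟧) f 0 (-n)
    exact ⟨fun _ _ _ => Subsingleton.elim _ _, fun f => ⟨0, Subsingleton.elim _ _⟩⟩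
  · obtain ⟨n, rfl⟩ := Int.eq_ofNat_of_zero_le hn
    let e := eM.homCongr ((F.mapDerivedCategory.commShiftIso (n : ℤ)).app
      ((DerivedCategory.singleFunctor C 0).obj N) ≪≫ (shiftFunctor _ (n : ℤ)).mapIso eN)
    have hcomm : e ∘ F.mapDerivedCategory.map ∘ Ext.homEquiv (X := M) (Y := N) (n := n) =
        Ext.homEquiv ∘ F.mapExtAddHom M N n := by
      ext x
      refine Eq.trans ?_ (Ext.mapExactFunctor_hom F x).symm
      simp [e, eM, eN, Iso.homCongr, ShiftedHom.map]
    have hb := (Ext.homEquiv (C := D)).bijective.comp (h M N n)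
    rw [← hcomm] at hb
    exact (Function.Bijective.of_comp_iff _ Ext.homEquiv.bijective).1
      ((Function.Bijective.of_comp_iff' e.bijective _).1 hb)

/-- If an exact functor induces bijections on all `Ext` groups, its derived functor is fully
faithful on bounded objects. -/
theorem isMapBijective_of_bounded
    (h : ∀ (M N : C) (n : ℕ), Function.Bijective (F.mapExtAddHom M N n))
    {X Y : DerivedCategory C} (hX : (DerivedCategory.TStructure.t (C := C)).bounded X)
    (hY : (DerivedCategory.TStructure.t (C := C)).bounded Y) :
    IsMapBijective F.mapDerivedCategory X Y := by
  let G := F.mapDerivedCategory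
  have hr (M : C) : ∀ n : ℤ, IsMapBijective G ((DerivedCategory.singleFunctor C 0).obj M) (Y⟦n⟧) :=
    let P : ObjectProperty (DerivedCategory C) := fun Y =>
      ∀ n : ℤ, IsMapBijective G ((DerivedCategory.singleFunctor C 0).obj M) (Y⟦n⟧)
    have : P.IsClosedUnderIsomorphisms :=
      ⟨fun e h n => (h n).of_iso (Iso.refl _) ((shiftFunctor _ n).mapIso e)⟩
    bounded_induction P
      (fun N m n => (isMapBijective_single F h M N (n - m)).of_iso (Iso.refl _)
        (singleFunctorShiftIso N m n))
      (fun Δ hΔ h₁ h₃ n => IsMapBijective.of_triangle_right (Triangle.shift_distinguished Δ hΔ n)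
        ((h₃ (n - 1)).of_iso (Iso.refl _) ((shiftFunctorAdd' _ n (-1) (n - 1) rfl).app _))
        (h₁ n) (h₃ n)
        ((h₁ (n + 1)).of_iso (Iso.refl _) ((shiftFunctorAdd' _ n 1 (n + 1) rfl).app _))) hY
  have hl : ∀ n : ℤ, IsMapBijective G (X⟦n⟧) Y :=
    let P : ObjectProperty (DerivedCategory C) := fun X => ∀ n : ℤ, IsMapBijective G (X⟦n⟧) Y
    have : P.IsClosedUnderIsomorphisms :=
      ⟨fun e h n => (h n).of_iso ((shiftFunctor _ n).mapIso e) (Iso.refl _)⟩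
    bounded_induction P
      (fun M m n => ((hr M (m - n)).shift (n - m)).of_iso (singleFunctorShiftIso M m n)
        ((shiftFunctorCompIsoId _ (m - n) (n - m) (by omega)).app Y))
      (fun Δ hΔ h₁ h₃ n => IsMapBijective.of_triangle_left (Triangle.shift_distinguished Δ hΔ n)
        ((h₃ (n - 1)).of_iso ((shiftFunctorAdd' _ n (-1) (n - 1) rfl).app _) (Iso.refl _))
        (h₁ n) (h₃ n)
        ((h₁ (n + 1)).of_iso ((shiftFunctorAdd' _ n 1 (n + 1) rfl).app _) (Iso.refl _))) hX
  exact (hl 0).of_iso ((shiftFunctorZero _ ℤ).app X) (Iso.refl _)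

end Bounded

end CategoryTheory

namespace IdempotentQuotient

open scoped ModuleCat

section

attribute [local instance] HasDerivedCategory.standard

/-- A ring homomorphism along which restriction of scalars is bijective on all `Ext` groups is a
homological epimorphism. -/
theorem isHomologicalEpi_of_ext {R S : Type u} [Ring R] [Ring S] (f : R →+* S)
    (h : ∀ (M N : ModuleCat.{u} S) (n : ℕ),
      Function.Bijective ((ModuleCat.restrictScalars.{u} f).mapExtAddHom M N n)) :
    IsHomologicalEpi f := by
  have key (X Y : DerivedCategory.Bounded (ModuleCat.{u} S)) :=
    isMapBijective_of_bounded (ModuleCat.restrictScalars.{u} f) h X.2 Y.2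
  refine ⟨⟨fun {X Y} g => ?_⟩, ⟨fun {X Y} g g' hg => ?_⟩⟩
  · obtain ⟨g', hg'⟩ := (key X Y).2
      ((DerivedCategory.TStructure.t (C := ModuleCat.{u} R)).bounded.ι.map g)
    exact ⟨ObjectProperty.homMk g', ObjectProperty.hom_ext _ hg'⟩
  · exact ObjectProperty.hom_ext _
      ((key X Y).1
        (congrArg (DerivedCategory.TStructure.t (C := ModuleCat.{u} R)).bounded.ι.map hg))

end

/-! ### Coinduced modules -/

section Coinduced

/-- The space `Hom_k(U, V)` for a right `R`-module `U` and a vector space `V`. It carries only its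
structure of a left `R`-module, so that the action of `k` on it is the one through `R`, as for any
other object of the category of `R`-modules. -/
def Coind (k : Type u) [Field k] (R : Type u) [Ring R] (U : Type u) [AddCommGroup U] [Module k U]
    [Module Rᵐᵒᵖ U] (V : Type u) [AddCommGroup V] [Module k V] : Type u := U →ₗ[k] V

variable (k : Type u) [Field k] (R : Type u) [Ring R]
  (U : Type u) [AddCommGroup U] [Module k U] [Module Rᵐᵒᵖ U]
  (V : Type u) [AddCommGroup V] [Module k V]

instance : AddCommGroup (Coind k R U V) := inferInstanceAs (AddCommGroup (U →ₗ[k] V))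

instance : FunLike (Coind k R U V) U V := inferInstanceAs (FunLike (U →ₗ[k] V) U V)

instance : LinearMapClass (Coind k R U V) k U V :=
  inferInstanceAs (LinearMapClass (U →ₗ[k] V) k U V)

variable {k R U V} in
@[ext]
theorem Coind.ext {f g : Coind k R U V} (h : ∀ x, f x = g x) : f = g := DFunLike.ext _ _ h

variable {k R U V}

/-- A linear map, as an element of the coinduced module. -/
def Coind.of (f : U →ₗ[k] V) : Coind k R U V := f

/-- The linear map underlying an element of the coinduced module. -/
def Coind.toLinearMap (f : Coind k R U V) : U →ₗ[k] V := f

variable [Algebra k R] [IsScalarTower k Rᵐᵒᵖ U]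

/-- The left `R`-module structure of `Hom_k(U, V)`: `(a • f) x = f (x · a)`. -/
instance : Module R (Coind k R U V) where
  smul a f := LinearMap.comp f.toLinearMap (Algebra.lsmul k k U (MulOpposite.op a))
  one_smul f := Coind.ext fun x => congrArg f (one_smul Rᵐᵒᵖ x)
  mul_smul a b f := Coind.ext fun x =>
    congrArg f (mul_smul (MulOpposite.op b) (MulOpposite.op a) x)
  smul_zero _ := rfl
  smul_add _ _ _ := rfl
  add_smul a b f := Coind.ext fun x =>
    (congrArg f (add_smul (MulOpposite.op a) (MulOpposite.op b) x)).trans (map_add f _ _)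
  zero_smul f := Coind.ext fun x => (congrArg f (zero_smul Rᵐᵒᵖ x)).trans (map_zero f)

@[simp] theorem Coind.smul_apply (a : R) (f : Coind k R U V) (x : U) :
    (a • f) x = f (MulOpposite.op a • x) := rfl

@[simp] theorem Coind.algebraMap_smul_apply (c : k) (f : Coind k R U V) (x : U) :
    (algebraMap k R c • f) x = c • f x := by
  rw [Coind.smul_apply, ← map_smul]
  congr 1
  rw [← algebraMap_smul Rᵐᵒᵖ c x]
  rfl

variable (R) in
/-- A map `U → U'` of right modules induces a map of coinduced modules. -/
def Coind.precomp {U' : Type u} [AddCommGroup U'] [Module k U'] [Module Rᵐᵒᵖ U']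
    [IsScalarTower k Rᵐᵒᵖ U'] (f : U →ₗ[Rᵐᵒᵖ] U') : Coind k R U' V →ₗ[R] Coind k R U V where
  toFun h := Coind.of (h.toLinearMap ∘ₗ f.restrictScalars k)
  map_add' _ _ := rfl
  map_smul' a h := Coind.ext fun x => by
    exact congrArg h (f.map_smul (MulOpposite.op a) x).symm

theorem Coind.precomp_surjective {U' : Type u} [AddCommGroup U'] [Module k U'] [Module Rᵐᵒᵖ U']
    [IsScalarTower k Rᵐᵒᵖ U'] (f : U →ₗ[Rᵐᵒᵖ] U') (hf : Function.Injective f) :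
    Function.Surjective (Coind.precomp R f : Coind k R U' V → Coind k R U V) := fun h => by
  obtain ⟨p, hp⟩ := LinearMap.exists_leftInverse_of_injective (f.restrictScalars k)
    (LinearMap.ker_eq_bot.2 hf)
  refine ⟨Coind.of (h.toLinearMap ∘ₗ p), Coind.ext fun x => ?_⟩
  exact congrArg h (LinearMap.congr_fun hp x)

/-- `Hom_k(R, V)` is injective: a linear map to it is determined by its composition with evaluation
at `1`, which is an arbitrary `k`-linear map to `V`. -/
theorem injective_coind : Module.Injective R (Coind k R R V) where
  out {X Y} _ _ _ _ f hf g := by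
    let _ : Module k X := Module.restrictScalars k R X
    let _ : Module k Y := Module.restrictScalars k R Y
    have : IsScalarTower k R X := IsScalarTower.restrictScalars k R X
    have : IsScalarTower k R Y := IsScalarTower.restrictScalars k R Y
    obtain ⟨p, hp⟩ := LinearMap.exists_leftInverse_of_injective (f.restrictScalars k)
      (LinearMap.ker_eq_bot.2 hf)
    replace hp (x : X) : p (f x) = x := LinearMap.congr_fun hp x
    let ev : X →ₗ[k] V :=
      { toFun x := g x 1
        map_add' x y := by rw [map_add]; rfl
        map_smul' c x := by
          rw [← algebraMap_smul R c x, map_smul, Coind.algebraMap_smul_apply]; rfl }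
    refine ⟨
      { toFun y := Coind.of (ev ∘ₗ p ∘ₗ (LinearMap.toSpanSingleton R Y y).restrictScalars k)
        map_add' y y' := Coind.ext fun a => ?_
        map_smul' b y := Coind.ext fun a => ?_ }, fun x => Coind.ext fun a => ?_⟩
    · change ev (p (a • (y + y'))) = ev (p (a • y)) + ev (p (a • y'))
      rw [smul_add, map_add, map_add]
    · change ev (p (a • b • y)) = ev (p ((a * b) • y))
      rw [mul_smul]
    · change g (p (a • f x)) 1 = g x a
      rw [← map_smul, hp, map_smul]
      change g x (1 * a) = _
      rw [one_mul]

variable (k R V) in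
/-- The coinduced module `Hom_k(R, V)`, as an object of the category of left `R`-modules. -/
def coindObj : ModuleCat.{u} R := ModuleCat.of R (Coind k R R V)

/-- An element of the coinduced module, as a map. -/
def coindMap (f : coindObj k R V) : Coind k R R V := f

theorem coindObj_ext {f g : coindObj k R V} (h : ∀ x, coindMap f x = coindMap g x) : f = g :=
  Coind.ext h

theorem coindMap_smul (c : k) (f : coindObj k R V) (x : R) :
    coindMap (c • f) x = c • coindMap f x :=
  Coind.algebraMap_smul_apply c (coindMap f) x

instance : Injective (coindObj k R V) :=
  Module.injective_object_of_injective_module (inj := injective_coind)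

variable (k) in
/-- The embedding `n ↦ (a ↦ a • n)` of a module `N` into `Hom_k(R, N)`. -/
def coindUnit (N : ModuleCat.{u} R) : N ⟶ coindObj k R N :=
  ModuleCat.ofHom (Y := Coind k R R N)
    { toFun n := Coind.of ((LinearMap.toSpanSingleton R N n).restrictScalars k)
      map_add' n n' := Coind.ext fun a => smul_add a n n'
      map_smul' b n := Coind.ext fun a => (mul_smul a b n).symm }

theorem coindUnit_apply (N : ModuleCat.{u} R) (n : N) (a : R) :
    coindMap (coindUnit k N n) a = a • n := rfl

instance (N : ModuleCat.{u} R) : Mono (coindUnit k N) := by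
  rw [ModuleCat.mono_iff_injective]
  intro n n' h
  have := DFunLike.congr_fun (congrArg coindMap h) (1 : R)
  rwa [coindUnit_apply, coindUnit_apply, one_smul, one_smul] at this

end Coinduced

/-! ### The bimodules `Hom_k(M, N)` -/

section HomBimodule

variable (k : Type u) [Field k] {R : Type u} [Ring R] [Algebra k R]

/-- The space `Hom_k(M, N)` for left `R`-modules `M` and `N`, on which `k` acts through `R`. -/
def HomMod (M N : ModuleCat.{u} R) : Type u := M →ₗ[k] N

section

variable {k} (M N : ModuleCat.{u} R)

instance : AddCommGroup (HomMod k M N) := inferInstanceAs (AddCommGroup (M →ₗ[k] N))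

instance : Module k (HomMod k M N) := inferInstanceAs (Module k (M →ₗ[k] N))

instance : FunLike (HomMod k M N) M N := inferInstanceAs (FunLike (M →ₗ[k] N) M N)

instance : LinearMapClass (HomMod k M N) k M N :=
  inferInstanceAs (LinearMapClass (M →ₗ[k] N) k M N)

variable {M N}

@[ext]
theorem HomMod.ext {f g : HomMod k M N} (h : ∀ x, f x = g x) : f = g := DFunLike.ext _ _ h

/-- A linear map, as an element of the bimodule `Hom_k(M, N)`. -/
def HomMod.of (f : M →ₗ[k] N) : HomMod k M N := f

/-- The linear map underlying an element of `Hom_k(M, N)`. -/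
def HomMod.toLinearMap (f : HomMod k M N) : M →ₗ[k] N := f

variable (M N)

/-- The left action of `R` on `Hom_k(M, N)`, through `N`. -/
instance : Module R (HomMod k M N) := inferInstanceAs (Module R (M →ₗ[k] N))

instance : IsScalarTower k R (HomMod k M N) := inferInstanceAs (IsScalarTower k R (M →ₗ[k] N))

/-- The right action of `R` on `Hom_k(M, N)`, through `M`. -/
instance : Module Rᵐᵒᵖ (HomMod k M N) where
  smul b f := LinearMap.comp f.toLinearMap (Algebra.lsmul k k M b.unop)
  one_smul f := HomMod.ext fun x => congrArg f (one_smul R x)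
  mul_smul a b f := HomMod.ext fun x => congrArg f (mul_smul b.unop a.unop x)
  smul_zero _ := rfl
  smul_add _ _ _ := rfl
  add_smul a b f := HomMod.ext fun x =>
    (congrArg f (add_smul a.unop b.unop x)).trans (map_add f _ _)
  zero_smul f := HomMod.ext fun x => (congrArg f (zero_smul R x)).trans (map_zero f)

instance : IsScalarTower k Rᵐᵒᵖ (HomMod k M N) where
  smul_assoc c b f := HomMod.ext fun x =>
    (congrArg f (smul_assoc c b.unop x)).trans (map_smul f c (b.unop • x))

instance : SMulCommClass R Rᵐᵒᵖ (HomMod k M N) := ⟨fun _ _ _ => rfl⟩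

/-- The bimodule structure of `Hom_k(M, N)`: `((a ⊗ b) • f) x = a • f (b • x)`. -/
instance : Module (Env k R) (HomMod k M N) := TensorProduct.Algebra.module

end

variable {k}

@[simp]
theorem HomMod.tmul_smul_apply {M N : ModuleCat.{u} R} (a : R) (b : Rᵐᵒᵖ) (f : HomMod k M N)
    (x : M) : ((a ⊗ₜ[k] b : Env k R) • f) x = a • f (b.unop • x) := rfl

theorem ofReg_tmul_smul (a : R) (b : Rᵐᵒᵖ) (x : regBimodule k R) :
    ofReg k R ((a ⊗ₜ[k] b : Env k R) • x) = a * (ofReg k R x * b.unop) := rfl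

theorem toReg_eq_left (a : R) : toReg k R a = (a ⊗ₜ[k] 1 : Env k R) • toReg k R 1 :=
  show a = a * (1 * 1) by rw [mul_one, mul_one]

theorem toReg_eq_right (a : R) :
    toReg k R a = (1 ⊗ₜ[k] MulOpposite.op a : Env k R) • toReg k R 1 :=
  show a = 1 * (1 * a) by rw [one_mul, one_mul]

/-- An additive map between modules over the enveloping algebra is linear if it is compatible with
pure tensors. -/
def envLinearMap {X Y : Type u} [AddCommGroup X] [AddCommGroup Y] [Module (Env k R) X]
    [Module (Env k R) Y] (f : X →+ Y)
    (h : ∀ (a : R) (b : Rᵐᵒᵖ) (x : X),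
      f ((a ⊗ₜ[k] b : Env k R) • x) = (a ⊗ₜ[k] b : Env k R) • f x) : X →ₗ[Env k R] Y where
  toFun := f
  map_add' := f.map_add
  map_smul' r x := by
    induction r using TensorProduct.induction_on with
    | zero =>
      exact (congrArg f (zero_smul (Env k R) x)).trans
        (f.map_zero.trans (zero_smul (Env k R) (f x)).symm)
    | tmul a b => exact h a b x
    | add r s hr hs =>
      rw [add_smul, map_add, hr, hs]
      exact (add_smul r s (f x)).symm

/-- Postcomposition `Hom_k(M, N) → Hom_k(M, N')`. -/
def HomMod.postcomp (M : ModuleCat.{u} R) {N N' : ModuleCat.{u} R} (f : N ⟶ N') :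
    HomMod k M N →ₗ[Env k R] HomMod k M N' :=
  envLinearMap
    { toFun h := HomMod.of (f.hom.restrictScalars k ∘ₗ h.toLinearMap)
      map_zero' := HomMod.ext fun _ => map_zero f.hom
      map_add' _ _ := HomMod.ext fun _ => map_add f.hom _ _ }
    fun a b h => HomMod.ext fun x => map_smul f.hom a (h (b.unop • x))

/-- Precomposition `Hom_k(M', N) → Hom_k(M, N)`. -/
def HomMod.precomp {M M' : ModuleCat.{u} R} (f : M ⟶ M') (N : ModuleCat.{u} R) :
    HomMod k M' N →ₗ[Env k R] HomMod k M N :=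
  envLinearMap
    { toFun h := HomMod.of (h.toLinearMap ∘ₗ f.hom.restrictScalars k)
      map_zero' := rfl
      map_add' _ _ := rfl }
    fun a b h => HomMod.ext fun x => by
      change a • h (b.unop • f x) = a • h (f (b.unop • x))
      rw [← map_smul f.hom]

variable (k)

/-- The functor `Hom_k(M, -)` from left `R`-modules to `R`-bimodules. -/
def homFunctor (M : ModuleCat.{u} R) : ModuleCat.{u} R ⥤ ModuleCat.{u} (Env k R) where
  obj N := ModuleCat.of (Env k R) (HomMod k M N)
  map f := ModuleCat.ofHom (HomMod.postcomp M f)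

variable (M : ModuleCat.{u} R)

/-- An element of the bimodule `Hom_k(M, N)` as an element of the underlying type. -/
def toHomMod {k : Type u} [Field k] [Algebra k R] {M N : ModuleCat.{u} R}
    (h : (homFunctor k M).obj N) : HomMod k M N := h

instance : (homFunctor k M).Additive where

instance : (homFunctor k M).Linear k where
  map_smul {N N'} f c := by
    ext h
    refine HomMod.ext fun x => ?_
    change algebraMap k R c • f (toHomMod h x) =
      algebraMap k R c • f (toHomMod h ((1 : Rᵐᵒᵖ).unop • x))
    rw [MulOpposite.unop_one, one_smul]

/-- Linear maps over a field extend and lift, so `Hom_k(M, -)` is exact. -/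
theorem homFunctor_exact (S : ShortComplex (ModuleCat.{u} R)) (hS : S.Exact) :
    (S.map (homFunctor k M)).Exact := by
  rw [ShortComplex.moduleCat_exact_iff] at hS ⊢
  intro h' hh
  let h : HomMod k M S.X₂ := toHomMod h'
  have hr (x : M) : h x ∈ LinearMap.range (S.f.hom.restrictScalars k) :=
    hS (h x) (DFunLike.congr_fun (f := HomMod.postcomp M S.g h) (g := 0) hh x)
  obtain ⟨g, hg⟩ := Module.projective_lifting_property (S.f.hom.restrictScalars k).rangeRestrict
    (h.toLinearMap.codRestrict _ hr) (LinearMap.surjective_rangeRestrict _)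
  exact ⟨HomMod.of g, HomMod.ext fun x => congrArg Subtype.val (LinearMap.congr_fun hg x)⟩

theorem homFunctor_preservesFinite : Limits.PreservesFiniteLimits (homFunctor k M) ∧
    Limits.PreservesFiniteColimits (homFunctor k M) :=
  ((Functor.exact_tfae (homFunctor k M)).out 1 3).mp (homFunctor_exact k M)

instance : Limits.PreservesFiniteLimits (homFunctor k M) :=
  (homFunctor_preservesFinite k M).1

instance : Limits.PreservesFiniteColimits (homFunctor k M) :=
  (homFunctor_preservesFinite k M).2

/-- The bimodule morphism `R → Hom_k(M, M)`, `a ↦ (m ↦ a • m)`. -/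
def actionMap : regBimodule k R ⟶ (homFunctor k M).obj M :=
  ModuleCat.ofHom (X := regBimodule k R) (Y := HomMod k M M) (envLinearMap
    { toFun a := HomMod.of (Algebra.lsmul k k M (ofReg k R a))
      map_zero' := HomMod.ext fun x => zero_smul R x
      map_add' a a' := HomMod.ext fun x => add_smul (ofReg k R a) (ofReg k R a') x }
    fun a b c => HomMod.ext fun x => by
      change (a * (ofReg k R c * b.unop)) • x = a • ofReg k R c • b.unop • x
      rw [mul_smul, mul_smul])

/-- `Hom_R(M, N) = Hom_{R ⊗ Rᵒᵖ}(R, Hom_k(M, N))`. -/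
theorem actionMap_comp_bijective (N : ModuleCat.{u} R) :
    Function.Bijective (fun f : M ⟶ N => actionMap k M ≫ (homFunctor k M).map f) := by
  constructor
  · intro f g h
    ext x
    have := DFunLike.congr_fun (congrArg (fun t : regBimodule k R ⟶ (homFunctor k M).obj N =>
      toHomMod (t (toReg k R 1))) h) x
    change f ((1 : R) • x) = g ((1 : R) • x) at this
    simpa using this
  · intro g
    let g₁ : HomMod k M N := toHomMod (g (toReg k R 1))
    have key (a : R) (x : M) : toHomMod (g (toReg k R a)) x = a • g₁ x ∧
        toHomMod (g (toReg k R a)) x = g₁ (a • x) := by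
      constructor
      · rw [toReg_eq_left, map_smul]
        change a • g₁ ((1 : R) • x) = _
        rw [one_smul]
      · rw [toReg_eq_right, map_smul]
        change (1 : R) • g₁ (a • x) = _
        rw [one_smul]
    refine ⟨ModuleCat.ofHom
      { toFun x := g₁ x
        map_add' := map_add g₁
        map_smul' a x := (key a x).2.symm.trans (key a x).1 }, ?_⟩
    ext a
    refine HomMod.ext fun x => ?_
    exact (key a x).2.symm

end HomBimodule

/-! ### `Ext` of bimodules with values in `Hom_k(M, N)` -/

noncomputable section ExtHom

variable {k : Type u} [Field k] {R : Type u} [Ring R] [Algebra k R]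
  (V : Type u) [AddCommGroup V] [Module k V]

/-- A bimodule, viewed as a right module. -/
abbrev rightRestrict (X : ModuleCat.{u} (Env k R)) : ModuleCat.{u} Rᵐᵒᵖ :=
  (ModuleCat.restrictScalars
    (Algebra.TensorProduct.includeRight : Rᵐᵒᵖ →ₐ[k] Env k R).toRingHom).obj X

theorem env_mul_smul {X : ModuleCat.{u} (Env k R)} (a a' : R) (b b' : Rᵐᵒᵖ) (x : X) :
    (a ⊗ₜ[k] b : Env k R) • (a' ⊗ₜ[k] b' : Env k R) • x =
      ((a * a') ⊗ₜ[k] (b * b') : Env k R) • x := by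
  rw [← mul_smul, Algebra.TensorProduct.tmul_mul_tmul]

/-- Linear maps of a bimodule `X` to `Hom_k(F, Hom_k(R, V))` correspond to linear maps of `F` to
`Hom_k(X, V)`. -/
def homCoindTranspose {F : ModuleCat.{u} R} {X : ModuleCat.{u} (Env k R)}
    (g : X →ₗ[Env k R] HomMod k F (coindObj k R V)) :
    F →ₗ[R] Coind k R (rightRestrict X) V where
  toFun m := Coind.of
    { toFun x := coindMap (g x m) 1
      map_add' x y := by
        have h : g (x + y) = g x + g y := map_add g x y
        rw [h]
        rfl
      map_smul' c x := by
        have h : g ((1 ⊗ₜ[k] algebraMap k Rᵐᵒᵖ c : Env k R) • x) =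
          (1 ⊗ₜ[k] algebraMap k Rᵐᵒᵖ c : Env k R) • g x := map_smul g _ x
        have h' : (g x) (c • m) = c • g x m := map_smul (g x) c m
        have h2 : (g ((1 ⊗ₜ[k] algebraMap k Rᵐᵒᵖ c : Env k R) • x)) m =
            algebraMap k R c • g x m := by
          rw [h, HomMod.tmul_smul_apply, one_smul]
          exact h'
        exact (congrArg (fun t : coindObj k R V => coindMap t 1) h2).trans
          (Coind.algebraMap_smul_apply c (coindMap (g x m)) 1) }
  map_add' m m' := Coind.ext fun x =>
    congrArg (fun t : coindObj k R V => coindMap t 1) (map_add (g x) m m')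
  map_smul' r m := Coind.ext fun x => by
    have h : g ((1 ⊗ₜ[k] MulOpposite.op r : Env k R) • x) =
      (1 ⊗ₜ[k] MulOpposite.op r : Env k R) • g x := map_smul g _ x
    have h2 : (g ((1 ⊗ₜ[k] MulOpposite.op r : Env k R) • x)) m = g x (r • m) := by
      rw [h, HomMod.tmul_smul_apply, one_smul]
      rfl
    exact (congrArg (fun t : coindObj k R V => coindMap t 1) h2).symm

/-- For `t : X → V`, the element `a ↦ t (a • x)` of `Hom_k(R, V)`. -/
def coindOrbit {X : ModuleCat.{u} (Env k R)} (t : Coind k R (rightRestrict X) V) (x : X) :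
    coindObj k R V := Coind.of (R := R) (U := R)
  { toFun a := t ((a ⊗ₜ[k] 1 : Env k R) • x : X)
    map_add' a a' := by
      have h : (((a + a') ⊗ₜ[k] 1 : Env k R) • x : X) =
        (a ⊗ₜ[k] 1 : Env k R) • x + (a' ⊗ₜ[k] 1 : Env k R) • x := by
        rw [TensorProduct.add_tmul, add_smul]
      exact (congrArg t h).trans (map_add t _ _)
    map_smul' c a := by
      have h : (((c • a) ⊗ₜ[k] 1 : Env k R) • x : X) =
        (1 ⊗ₜ[k] algebraMap k Rᵐᵒᵖ c : Env k R) • (a ⊗ₜ[k] 1 : Env k R) • x := by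
        rw [env_mul_smul, TensorProduct.smul_tmul, one_mul, mul_one,
          Algebra.algebraMap_eq_smul_one]
      exact (congrArg t h).trans
        (map_smul (X := rightRestrict X) t c ((a ⊗ₜ[k] 1 : Env k R) • x : X)) }

/-- The inverse construction to `homCoindTranspose`. -/
def homCoindUntranspose {F : ModuleCat.{u} R} {X : ModuleCat.{u} (Env k R)}
    (g : F →ₗ[R] Coind k R (rightRestrict X) V) :
    X →ₗ[Env k R] HomMod k F (coindObj k R V) :=
  envLinearMap
    { toFun x := HomMod.of
        { toFun m := coindOrbit V (g m) x
          map_add' m m' := coindObj_ext fun a =>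
            congrArg (fun t : Coind k R (rightRestrict X) V => t ((a ⊗ₜ[k] 1 : Env k R) • x : X))
              (map_add g m m')
          map_smul' c m := coindObj_ext fun a => by
            rw [RingHom.id_apply, coindMap_smul]
            exact (congrArg (fun t : Coind k R (rightRestrict X) V =>
              t ((a ⊗ₜ[k] 1 : Env k R) • x : X)) (map_smul g (algebraMap k R c) m)).trans
              (Coind.algebraMap_smul_apply c (g m) _) }
      map_zero' := HomMod.ext fun m => coindObj_ext fun a =>
        (congrArg (g m) (smul_zero (M := Env k R) (A := X) _)).trans (map_zero (g m))
      map_add' x y := HomMod.ext fun m => coindObj_ext fun a =>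
        (congrArg (g m) (smul_add (M := Env k R) (A := X) _ x y)).trans (map_add (g m) _ _) }
    fun b d x => HomMod.ext fun m => coindObj_ext fun a => by
      have h := DFunLike.congr_fun (map_smul g d.unop m)
        (((a * b) ⊗ₜ[k] 1 : Env k R) • x : X)
      refine Eq.trans (congrArg (g m) ?_) h.symm
      change (a ⊗ₜ[k] 1 : Env k R) • (b ⊗ₜ[k] d : Env k R) • x =
        (1 ⊗ₜ[k] d : Env k R) • ((a * b) ⊗ₜ[k] 1 : Env k R) • x
      rw [env_mul_smul, env_mul_smul, one_mul, one_mul, mul_one]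

/-- If `F` is projective, `Hom_k(F, Hom_k(R, V))` is an injective bimodule. -/
theorem injective_hom_coind (F : ModuleCat.{u} R) [Projective F] :
    Injective ((homFunctor k F).obj (coindObj k R V)) := by
  have hF : Module.Projective R F := (IsProjective.iff_projective F).2 inferInstance
  constructor
  intro X Y g f hf
  -- transposing, the extension problem becomes a lifting problem for the projective module `F`
  -- along the surjection `Hom_k(Y, V) → Hom_k(X, V)`
  let f' : rightRestrict X →ₗ[Rᵐᵒᵖ] rightRestrict Y := ((ModuleCat.restrictScalars
    (Algebra.TensorProduct.includeRight : Rᵐᵒᵖ →ₐ[k] Env k R).toRingHom).map f).hom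
  obtain ⟨G, hG⟩ := Module.projective_lifting_property _ (homCoindTranspose V g.hom)
    (Coind.precomp_surjective (V := V) f' ((ModuleCat.mono_iff_injective f).1 hf))
  refine ⟨ModuleCat.ofHom (homCoindUntranspose V G), ?_⟩
  ext x
  refine HomMod.ext fun m => coindObj_ext fun a => ?_
  have h1 := DFunLike.congr_fun (LinearMap.congr_fun hG m) ((a ⊗ₜ[k] 1 : Env k R) • x : X)
  have h2 : f ((a ⊗ₜ[k] 1 : Env k R) • x) = (a ⊗ₜ[k] 1 : Env k R) • f x := map_smul f.hom _ x
  have h3 : toHomMod (g ((a ⊗ₜ[k] 1 : Env k R) • x)) = (a ⊗ₜ[k] 1 : Env k R) • toHomMod (g x) :=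
    map_smul g.hom _ x
  refine (congrArg (G m) h2.symm).trans (h1.trans ?_)
  change coindMap (toHomMod (g ((a ⊗ₜ[k] 1 : Env k R) • x)) m) (1 : R) =
    coindMap (toHomMod (g x) m) a
  rw [h3, HomMod.tmul_smul_apply, MulOpposite.unop_one, one_smul]
  exact congrArg (coindMap (toHomMod (g x) m)) (one_mul a)

variable (k) in
/-- The sequence of bimodules `Hom_k(S, N)` for a short exact sequence `S` of modules. -/
def homShortComplex (S : ShortComplex (ModuleCat.{u} R)) (N : ModuleCat.{u} R) :
    ShortComplex (ModuleCat.{u} (Env k R)) where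
  X₁ := (homFunctor k S.X₃).obj N
  X₂ := (homFunctor k S.X₂).obj N
  X₃ := (homFunctor k S.X₁).obj N
  f := ModuleCat.ofHom (HomMod.precomp S.g N)
  g := ModuleCat.ofHom (HomMod.precomp S.f N)
  zero := by
    ext h
    refine HomMod.ext fun x => ?_
    have h0 : S.g (S.f x) = 0 := congrArg (fun t => t.hom x) S.zero
    exact (congrArg (toHomMod h) h0).trans (map_zero (toHomMod h))

theorem homShortComplex_shortExact {S : ShortComplex (ModuleCat.{u} R)} (hS : S.ShortExact)
    (N : ModuleCat.{u} R) : (homShortComplex k S N).ShortExact where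
  exact := by
    rw [ShortComplex.moduleCat_exact_iff]
    intro h hh
    obtain ⟨s, hs⟩ := LinearMap.exists_rightInverse_of_surjective (S.g.hom.restrictScalars k)
      (LinearMap.range_eq_top.2 hS.moduleCat_surjective_g)
    refine ⟨HomMod.of ((toHomMod h).toLinearMap ∘ₗ s), HomMod.ext fun x => ?_⟩
    change toHomMod h (s (S.g x)) = toHomMod h x
    obtain ⟨y, hy⟩ := (ShortComplex.moduleCat_exact_iff S).1 hS.exact (s (S.g x) - x) (by
      rw [map_sub, sub_eq_zero]
      exact LinearMap.congr_fun hs (S.g x))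
    rw [← sub_eq_zero, ← map_sub, ← hy]
    exact DFunLike.congr_fun (congrArg toHomMod hh) y
  mono_f := (ModuleCat.mono_iff_injective _).2 fun h h' hh => HomMod.ext fun x => by
    obtain ⟨y, rfl⟩ := hS.moduleCat_surjective_g x
    exact DFunLike.congr_fun (congrArg toHomMod hh) y
  epi_g := (ModuleCat.epi_iff_surjective _).2 fun h => by
    obtain ⟨p, hp⟩ := LinearMap.exists_leftInverse_of_injective (S.f.hom.restrictScalars k)
      (LinearMap.ker_eq_bot.2 hS.moduleCat_injective_f)
    refine ⟨HomMod.of ((toHomMod h).toLinearMap ∘ₗ p), HomMod.ext fun x => ?_⟩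
    exact congrArg (toHomMod h) (LinearMap.congr_fun hp x)

/-- `Hom_k(M, Hom_k(R, V))` is acyclic for `Ext(R, -)`, by dimension shifting along a projective
presentation of `M`. -/
theorem subsingleton_ext_hom_coind (M : ModuleCat.{u} R) (n : ℕ) :
    Subsingleton (Abelian.Ext.{u} (regBimodule k R)
      ((homFunctor k M).obj (coindObj k R V)) (n + 1)) := by
  let S (M : ModuleCat.{u} R) := ShortComplex.mk _ _ (Limits.kernel.condition (Projective.π M))
  have hS (M) : (S M).ShortExact := { exact := ShortComplex.exact_kernel (Projective.π M) }
  have hT (M) := homShortComplex_shortExact (k := k) (hS M) (coindObj k R V)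
  have hI (M) : Injective (homShortComplex k (S M) (coindObj k R V)).X₂ :=
    injective_hom_coind V (Projective.over M)
  induction n generalizing M with
  | zero =>
    refine subsingleton_ext_one_of_lift (hT M) (Abelian.Ext.subsingleton_of_injective _ _ _)
      fun f => ?_
    obtain ⟨g, rfl⟩ := (actionMap_comp_bijective k (S M).X₁ (coindObj k R V)).2 f
    -- a morphism on the kernel extends, as the coinduced module is injective
    obtain ⟨g', rfl⟩ : ∃ g', (S M).f ≫ g' = g := ⟨_, Injective.comp_factorThru g (S M).f⟩
    refine ⟨actionMap k (S M).X₂ ≫ (homFunctor k (S M).X₂).map g', ?_⟩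
    ext a
    refine HomMod.ext fun x => ?_
    exact congrArg g'.hom (map_smul (S M).f.hom (ofReg k R a) x).symm
  | succ n ih =>
    exact subsingleton_ext_succ (hT M) (Abelian.Ext.subsingleton_of_injective _ _ _)
      (ih (S M).X₁)

/-- `Ext_R^n(M, N) = Ext_{R ⊗ Rᵒᵖ}^n(R, Hom_k(M, N))`. -/
theorem extTransfer_actionMap_bijective (M N : ModuleCat.{u} R) (n : ℕ) :
    Function.Bijective (extTransfer (homFunctor k M) (actionMap k M) N n) :=
  extTransfer_bijective _ _ (actionMap_comp_bijective k M)
    (fun N => ⟨coindObj k R N, coindUnit k N, inferInstance,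
      fun _ => Abelian.Ext.subsingleton_of_injective _ _ _,
      fun n => subsingleton_ext_hom_coind N M n⟩) N n

variable (k) in
/-- The linear isomorphism `Ext_R^n(M, N) = Ext_{R ⊗ Rᵒᵖ}^n(R, Hom_k(M, N))`. -/
def extHomEquiv (M N : ModuleCat.{u} R) (n : ℕ) :
    Abelian.Ext.{u} M N n ≃ₗ[k]
      Abelian.Ext.{u} (regBimodule k R) ((homFunctor k M).obj N) n :=
  LinearEquiv.ofBijective
    { toFun := extTransfer (homFunctor k M) (actionMap k M) N n
      map_add' := map_add _
      map_smul' := extTransfer_smul k _ _ }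
    (extTransfer_actionMap_bijective M N n)

end ExtHom

/-! ### Restriction along `A → A ⧸ AeA` -/

noncomputable section Restriction

variable {k : Type u} [Field k] {A : Type u} [Ring A] [Algebra k A] {B : Type u} [Ring B]
  [Algebra k B] (φ : A →ₐ[k] B)

/-- Restriction of scalars from `B`-modules to `A`-modules. -/
abbrev resFunctor : ModuleCat.{u} B ⥤ ModuleCat.{u} A :=
  ModuleCat.restrictScalars.{u} φ.toRingHom

variable (e : A) (V : Type u) [AddCommGroup V] [Module k V]

theorem mul_eq_self_of_mem_rightPart {e : A} (he : IsIdempotentElem e) {y : A}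
    (hy : y ∈ rightPart e) : e * y = y := by
  obtain ⟨b, rfl⟩ := Submodule.mem_span_singleton.mp hy
  rw [MulOpposite.smul_eq_mul_unop, ← mul_assoc, he.eq]

variable (k) in
/-- The injective module `Hom_k(eA, Hom_k(Ae, V)) = Hom_k(Ae ⊗ eA, V)`. -/
def coindPart : ModuleCat.{u} A :=
  ModuleCat.of A (Coind k A (rightPart e) (leftPart e →ₗ[k] V))

/-- An element of `Hom_k(eA, Hom_k(Ae, V))`, as a map. -/
def coindPartMap {V : Type u} [AddCommGroup V] [Module k V] (h : coindPart k e V) :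
    Coind k A (rightPart e) (leftPart e →ₗ[k] V) := h

variable {e V} in
theorem coindPart_ext {h h' : coindPart k e V}
    (hh : ∀ y, coindPartMap e h y = coindPartMap e h' y) : h = h' :=
  Coind.ext hh

/-- Since `eA` is a direct summand of `A` as a right module, `Hom_k(eA, Hom_k(Ae, V))` is a direct
summand of a coinduced module. -/
theorem injective_coindPart (he : IsIdempotentElem e) : Injective (coindPart k e V) := by
  let i : A →ₗ[Aᵐᵒᵖ] rightPart e :=
    { toFun a := ⟨e * a, Submodule.mem_span_singleton.2 ⟨MulOpposite.op a, rfl⟩⟩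
      map_add' a b := Subtype.ext (mul_add e a b)
      map_smul' b a := Subtype.ext (mul_assoc e a b.unop).symm }
  let s : coindPart k e V ⟶ coindObj k A (leftPart e →ₗ[k] V) :=
    ModuleCat.ofHom (X := Coind k A (rightPart e) (leftPart e →ₗ[k] V))
      (Y := Coind k A A (leftPart e →ₗ[k] V)) (Coind.precomp A i)
  let r : coindObj k A (leftPart e →ₗ[k] V) ⟶ coindPart k e V :=
    ModuleCat.ofHom (X := Coind k A A (leftPart e →ₗ[k] V))
      (Y := Coind k A (rightPart e) (leftPart e →ₗ[k] V)) (Coind.precomp A (rightPart e).subtype)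
  have hsr : s ≫ r = 𝟙 _ := by
    ext h
    refine coindPart_ext fun y => ?_
    exact congrArg (coindPartMap e h)
      (Subtype.ext (mul_eq_self_of_mem_rightPart he y.2))
  constructor
  intro X Y g f hf
  refine ⟨Injective.factorThru (g ≫ s) f ≫ r, ?_⟩
  rw [← Category.assoc, Injective.comp_factorThru, Category.assoc, hsr, Category.comp_id]

/-- The map `Hom_k(B, V) → Hom_k(A, V)`. -/
def coindInfl : (resFunctor φ).obj (coindObj k B V) ⟶ coindObj k A V :=
  ModuleCat.ofHom (X := (resFunctor φ).obj (coindObj k B V)) (Y := Coind k A A V)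
    { toFun h := Coind.of ((coindMap (k := k) (R := B) (V := V) h).toLinearMap ∘ₗ φ.toLinearMap)
      map_add' _ _ := rfl
      map_smul' a h := Coind.ext fun x =>
        congrArg (coindMap (k := k) (R := B) (V := V) h) (map_mul φ x a).symm }

/-- The restriction map `Hom_k(A, V) → Hom_k(Ae ⊗ eA, V)`. -/
def coindRes : coindObj k A V ⟶ coindPart k e V :=
  ModuleCat.ofHom (X := Coind k A A V) (Y := Coind k A (rightPart e) (leftPart e →ₗ[k] V))
    { toFun h := Coind.of (LinearMap.mk₂ k (fun (y : rightPart e) (x : leftPart e) => h (x.1 * y.1))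
        (fun y y' x => by simp [mul_add])
        (fun c y x => by simp)
        (fun y x x' => by simp [add_mul])
        (fun c y x => by simp))
      map_add' _ _ := rfl
      map_smul' a h := Coind.ext fun y => LinearMap.ext fun x =>
        congrArg h (mul_assoc x.1 y.1 a) }

variable {φ e}

/-- The dual of `0 → Ae ⊗ eA → A → B → 0`. -/
def coindShortComplex (hker : ∀ x, φ x = 0 ↔ x ∈ AeA e) (he : IsIdempotentElem e) :
    ShortComplex (ModuleCat.{u} A) where
  f := coindInfl φ V
  g := coindRes e V
  zero := by
    ext h
    refine coindPart_ext fun y => LinearMap.ext fun x => ?_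
    exact (congrArg (coindMap h) ((hker _).2 (mul_mem_AeA he x.2 y.2))).trans
      (map_zero (coindMap h))

theorem coindShortComplex_shortExact (hφ : Function.Surjective φ)
    (hker : ∀ x, φ x = 0 ↔ x ∈ AeA e) (he : IsIdempotentElem e)
    (hmul : Function.Bijective (mulMap k e he)) : (coindShortComplex V hker he).ShortExact where
  exact := by
    rw [ShortComplex.moduleCat_exact_iff]
    intro (h : coindObj k A V) hh
    -- a linear form in the kernel vanishes on `AeA`, since `Ae ⊗ eA → AeA` is surjective
    have h0 (z : AeA e) : coindMap h z.1 = 0 := by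
      obtain ⟨t, rfl⟩ := hmul.2 z
      induction t using TensorProduct.induction_on with
      | zero => rw [map_zero]; exact map_zero (coindMap h)
      | tmul x y =>
        exact LinearMap.congr_fun (DFunLike.congr_fun (congrArg (coindPartMap e) hh) y) x
      | add s t hs ht =>
        rw [map_add]
        exact (map_add (coindMap h) _ _).trans (by rw [hs, ht, add_zero])
    obtain ⟨s, hs⟩ := LinearMap.exists_rightInverse_of_surjective φ.toLinearMap
      (LinearMap.range_eq_top.2 hφ)
    refine ⟨Coind.of (R := B) (U := B) ((coindMap h).toLinearMap ∘ₗ s), coindObj_ext fun x => ?_⟩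
    change coindMap h (s (φ x)) = coindMap h x
    rw [← sub_eq_zero, ← map_sub]
    refine h0 ⟨_, (hker _).1 ?_⟩
    rw [map_sub, sub_eq_zero]
    exact LinearMap.congr_fun hs (φ x)
  mono_f := (ModuleCat.mono_iff_injective _).2 fun h h' hh => coindObj_ext (k := k) fun b => by
    obtain ⟨x, rfl⟩ := hφ b
    exact DFunLike.congr_fun (congrArg coindMap hh) x
  epi_g := (ModuleCat.epi_iff_surjective _).2 fun q => by
    let L : (leftPart e) ⊗[k] (rightPart e) →ₗ[k] V :=
      TensorProduct.lift (coindPartMap e q).toLinearMap.flip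
    -- a linear form on `Ae ⊗ eA ≅ AeA` extends to `A`
    obtain ⟨h, hh⟩ := LinearMap.exists_extend (p := (AeA e).restrictScalars k)
      (L ∘ₗ (LinearEquiv.ofBijective _ hmul).symm.toLinearMap)
    refine ⟨Coind.of (R := A) (U := A) h, coindPart_ext fun y => LinearMap.ext fun x => ?_⟩
    have h1 := LinearMap.congr_fun hh (mulMap k e he (x ⊗ₜ y))
    refine h1.trans ?_
    change L ((LinearEquiv.ofBijective _ hmul).symm
      (LinearEquiv.ofBijective _ hmul (x ⊗ₜ y))) = _
    rw [LinearEquiv.symm_apply_apply]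
    rfl

/-- There are no nonzero maps from a `B`-module `M` to `Hom_k(eA, Hom_k(Ae, V))`: as `y = e y` in
`eA` kills `M`, one has `f m y = (y • f m) e = f (y • m) e = 0`. -/
theorem hom_coindPart_eq_zero (hker : ∀ x, φ x = 0 ↔ x ∈ AeA e) (he : IsIdempotentElem e)
    (M : ModuleCat.{u} B) (f : (resFunctor φ).obj M ⟶ coindPart k e V) : f = 0 := by
  ext m
  refine coindPart_ext fun y => ?_
  have hy := mul_eq_self_of_mem_rightPart he y.2
  have hy' : φ y.1 = 0 :=
    (hker _).2 (Ideal.subset_span ⟨1, y.1, by rw [one_mul, hy]⟩)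
  have h1 : f (y.1 • m) = y.1 • f m := map_smul f.hom y.1 m
  have h2 : (y.1 • m : (resFunctor φ).obj M) = 0 :=
    (congrArg (fun b : B => b • (m : M)) hy').trans (zero_smul B (m : M))
  rw [h2, map_zero] at h1
  have h3 := DFunLike.congr_fun (congrArg (coindPartMap e) h1)
    ⟨e, Submodule.mem_span_singleton_self e⟩
  refine Eq.trans ?_ h3.symm
  exact congrArg (coindPartMap e (f m))
    (Subtype.ext hy.symm)

/-- `B`-modules coinduced from `k` are acyclic for `Ext_A(M, -)`, for any `B`-module `M`:
`coindShortComplex` is an injective resolution, and `M` has no maps to its last term. -/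
theorem subsingleton_ext_res_coind (hφ : Function.Surjective φ)
    (hker : ∀ x, φ x = 0 ↔ x ∈ AeA e) (he : IsIdempotentElem e)
    (hmul : Function.Bijective (mulMap k e he)) (M : ModuleCat.{u} B) (n : ℕ) :
    Subsingleton (Abelian.Ext.{u} ((resFunctor φ).obj M)
      ((resFunctor φ).obj (coindObj k B V)) (n + 1)) := by
  have hS := coindShortComplex_shortExact V hφ hker he hmul
  have : Injective (coindShortComplex V hker he).X₂ := inferInstanceAs (Injective (coindObj k A V))
  have : Injective (coindShortComplex V hker he).X₃ := injective_coindPart e V he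
  cases n with
  | zero =>
    exact subsingleton_ext_one_of_lift hS (Abelian.Ext.subsingleton_of_injective _ _ _)
      fun f => ⟨0, by rw [Limits.zero_comp]; exact (hom_coindPart_eq_zero V hker he M f).symm⟩
  | succ n =>
    exact subsingleton_ext_succ hS (Abelian.Ext.subsingleton_of_injective _ _ _)
      (Abelian.Ext.subsingleton_of_injective _ _ _)

theorem resFunctor_map_bijective (hφ : Function.Surjective φ) (M N : ModuleCat.{u} B) :
    Function.Bijective (fun f : M ⟶ N => (resFunctor φ).map f) := by
  constructor
  · intro f g h
    ext x
    exact congrArg (fun t => t.hom x) h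
  · intro f
    refine ⟨ModuleCat.ofHom
      { toFun := f.hom
        map_add' := f.hom.map_add
        map_smul' b x := ?_ }, rfl⟩
    obtain ⟨a, rfl⟩ := hφ b
    exact f.hom.map_smul a x

/-- Restriction of scalars along `A → B` is bijective on `Ext` groups. -/
theorem resFunctor_ext_bijective (hφ : Function.Surjective φ)
    (hker : ∀ x, φ x = 0 ↔ x ∈ AeA e) (he : IsIdempotentElem e)
    (hmul : Function.Bijective (mulMap k e he)) (M N : ModuleCat.{u} B) (n : ℕ) :
    Function.Bijective ((resFunctor φ).mapExtAddHom M N n) := by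
  have h := extTransfer_bijective (resFunctor φ) (𝟙 ((resFunctor φ).obj M))
    (fun N => by simpa using resFunctor_map_bijective hφ M N)
    (fun N => ⟨coindObj k B N, coindUnit k N, inferInstance,
      fun _ => Abelian.Ext.subsingleton_of_injective _ _ _,
      fun n => subsingleton_ext_res_coind N hφ hker he hmul M n⟩) N n
  have h' : extTransfer (resFunctor φ) (𝟙 ((resFunctor φ).obj M)) N n =
      (resFunctor φ).mapExtAddHom M N n := by
    ext x
    exact Abelian.Ext.mk₀_id_comp _
  rwa [h'] at h

/-- A quotient map by `AeA` is a homological epimorphism. -/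
theorem isHomologicalEpi_toRingHom (hφ : Function.Surjective φ)
    (hker : ∀ x, φ x = 0 ↔ x ∈ AeA e) (he : IsIdempotentElem e)
    (hmul : Function.Bijective (mulMap k e he)) : IsHomologicalEpi φ.toRingHom :=
  isHomologicalEpi_of_ext _ (resFunctor_ext_bijective hφ hker he hmul)

end Restriction

/-! ### Hochschild cohomology of the quotient -/

noncomputable section HochschildRestriction

variable {k : Type u} [Field k] {A : Type u} [Ring A] [Algebra k A] {B : Type u} [Ring B]
  [Algebra k B] (φ : A →ₐ[k] B)

instance : (ModuleCat.restrictScalars.{u} (envMap φ)).Linear k where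
  map_smul {M N} f c := by
    ext x
    exact (congrArg (fun b : Env k B => b • f.hom (x : M))
      ((Algebra.TensorProduct.map φ (AlgHom.op φ)).commutes c)).symm

theorem resFunctor_algebraMap_smul {M : ModuleCat.{u} B} (c : k)
    (x : (resFunctor φ).obj M) :
    algebraMap k A c • x = algebraMap k B c • (x : M) :=
  congrArg (fun b : B => b • (x : M)) (φ.commutes c)

/-- Restricting `Hom_k(M, N)` to an `A`-bimodule is the same as restricting `M` and `N`: the
actions of `k` through `A` and through `B` agree. -/
def homResMap (M N : ModuleCat.{u} B) :
    (ModuleCat.restrictScalars.{u} (envMap φ)).obj ((homFunctor k M).obj N) →ₗ[Env k A]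
      HomMod k ((resFunctor φ).obj M) ((resFunctor φ).obj N) :=
  envLinearMap
    { toFun h := HomMod.of (k := k) (M := (resFunctor φ).obj M) (N := (resFunctor φ).obj N)
        { toFun x := toHomMod (k := k) (M := M) (N := N) h x
          map_add' x y := map_add (toHomMod (k := k) (M := M) (N := N) h) x y
          map_smul' c x := by
            refine (congrArg (toHomMod (k := k) (M := M) (N := N) h)
              (resFunctor_algebraMap_smul φ c (x : M))).trans ?_
            refine (LinearMap.map_smul
              (toHomMod (k := k) (M := M) (N := N) h).toLinearMap c x).trans ?_
            exact (resFunctor_algebraMap_smul φ c _).symm }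
      map_zero' := rfl
      map_add' _ _ := rfl }
    fun _ _ _ => rfl

theorem homResMap_bijective (M N : ModuleCat.{u} B) :
    Function.Bijective (homResMap φ (k := k) M N) := by
  constructor
  · intro f g h
    exact HomMod.ext (k := k) (M := M) (N := N) fun x => DFunLike.congr_fun h x
  · intro h
    refine ⟨HomMod.of (k := k) (M := M) (N := N)
      { toFun x := h x
        map_add' x y := map_add h x y
        map_smul' c x := ?_ }, rfl⟩
    refine (congrArg h (resFunctor_algebraMap_smul φ c (x : M)).symm).trans ?_
    refine (LinearMap.map_smul h.toLinearMap c x).trans ?_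
    exact resFunctor_algebraMap_smul φ c (h x : N)

/-- The isomorphism given by `homResMap`. -/
def homResIso (M N : ModuleCat.{u} B) :
    (ModuleCat.restrictScalars.{u} (envMap φ)).obj ((homFunctor k M).obj N) ≅
      (homFunctor k ((resFunctor φ).obj M)).obj ((resFunctor φ).obj N) :=
  (LinearEquiv.ofBijective _ (homResMap_bijective φ M N)).toModuleIso

/-- `Hom_{B^e}(B, N) = Hom_{A^e}(A, N)` for a quotient `B` of `A`. -/
theorem regMap_comp_bijective (hφ : Function.Surjective φ) (N : ModuleCat.{u} (Env k B)) :
    Function.Bijective (fun f : regBimodule k B ⟶ N =>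
      regMap φ ≫ (ModuleCat.restrictScalars.{u} (envMap φ)).map f) := by
  constructor
  · intro f g h
    ext b
    obtain ⟨a, ha⟩ := hφ (ofReg k B b)
    have := congrArg (fun t => t.hom (toReg k A a)) h
    change f (toReg k B (φ a)) = g (toReg k B (φ a)) at this
    rwa [ha] at this
  · intro g
    let n : N := g (toReg k A 1)
    have key (a : A) : g (toReg k A a) = (φ a ⊗ₜ[k] 1 : Env k B) • n ∧
        g (toReg k A a) = (1 ⊗ₜ[k] MulOpposite.op (φ a) : Env k B) • n := by
      constructor
      · rw [toReg_eq_left, map_smul]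
        change (φ a ⊗ₜ[k] AlgHom.op φ 1 : Env k B) • n = _
        rw [map_one]
      · rw [toReg_eq_right, map_smul]
        change (φ 1 ⊗ₜ[k] AlgHom.op φ (MulOpposite.op a) : Env k B) • n = _
        rw [map_one]
        rfl
    have comm (b : B) : (b ⊗ₜ[k] 1 : Env k B) • n = (1 ⊗ₜ[k] MulOpposite.op b : Env k B) • n := by
      obtain ⟨a, rfl⟩ := hφ b
      exact (key a).1.symm.trans (key a).2
    refine ⟨ModuleCat.ofHom (X := regBimodule k B) (envLinearMap
      { toFun b := (ofReg k B b ⊗ₜ[k] 1 : Env k B) • n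
        map_zero' := ?_
        map_add' b b' := ?_ } fun b d x => ?_), ?_⟩
    · change ((0 : B) ⊗ₜ[k] 1 : Env k B) • n = 0
      rw [TensorProduct.zero_tmul]
      exact zero_smul (Env k B) n
    · change ((ofReg k B b + ofReg k B b') ⊗ₜ[k] 1 : Env k B) • n = _
      rw [TensorProduct.add_tmul, add_smul]
    · change ((b * (ofReg k B x * d.unop)) ⊗ₜ[k] 1 : Env k B) • n =
        (b ⊗ₜ[k] d : Env k B) • (ofReg k B x ⊗ₜ[k] 1 : Env k B) • n
      have h1 := env_mul_smul (b * ofReg k B x) d.unop 1 1 n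
      rw [comm, env_mul_smul, mul_one, one_mul, mul_one, mul_assoc] at h1
      rw [env_mul_smul, ← h1, mul_one]
      rfl
    · ext a
      exact (key (ofReg k A a)).1.symm

theorem subsingleton_ext_of_iso {R : Type u} [Ring R] {X Y Y' : ModuleCat.{u} R} (i : Y ≅ Y')
    {n : ℕ} (h : Subsingleton (Abelian.Ext.{u} X Y' n)) :
    Subsingleton (Abelian.Ext.{u} X Y n) := by
  refine subsingleton_of_forall_eq 0 fun x => ?_
  have h1 : (x.comp (Abelian.Ext.mk₀ i.hom) (add_zero n)).comp (Abelian.Ext.mk₀ i.inv)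
      (add_zero n) = x := by
    rw [Abelian.Ext.comp_assoc_of_third_deg_zero, Abelian.Ext.mk₀_comp_mk₀, i.hom_inv_id,
      Abelian.Ext.comp_mk₀_id]
  rw [← h1, h.elim (x.comp _ _) 0, Abelian.Ext.zero_comp]

variable (k B) in
/-- The bimodule `Hom_k(B, Hom_k(B, V))`. -/
abbrev biCoind (V : Type u) [AddCommGroup V] [Module k V] : ModuleCat.{u} (Env k B) :=
  (homFunctor k (ModuleCat.of B B)).obj (coindObj k B V)

/-- The embedding `n ↦ (m ↦ (b ↦ b • n • m))` of a bimodule into `Hom_k(B, Hom_k(B, N))`. -/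
def biCoindUnit (N : ModuleCat.{u} (Env k B)) : N ⟶ biCoind k B (rightRestrict N) :=
  ModuleCat.ofHom (Y := HomMod k (ModuleCat.of B B) (coindObj k B (rightRestrict N)))
    (homCoindUntranspose (rightRestrict N)
      { toFun m := Coind.of ((Algebra.lsmul k k (rightRestrict N)) (MulOpposite.op m))
        map_add' m m' := Coind.ext fun n => add_smul (MulOpposite.op m) (MulOpposite.op m') n
        map_smul' b m := Coind.ext fun n =>
          mul_smul (MulOpposite.op m) (MulOpposite.op b) n })

instance (N : ModuleCat.{u} (Env k B)) : Mono (biCoindUnit N) := by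
  rw [ModuleCat.mono_iff_injective]
  have key (n : N) : coindMap (toHomMod (biCoindUnit N n) (1 : B)) 1 = (n : N) :=
    (one_smul (Env k B) _).trans (one_smul (Env k B) n)
  intro n n' h
  rw [← key n, ← key n', h]

variable {φ} {e : A}

/-- The change of rings map `HH^n(B) → Ext^n_{A^e}(A, B)` is bijective. The bimodules
`Hom_k(B, Hom_k(B, V))` are acyclic over `A` because `Ext^n_{A^e}(A, -)` takes them to
`Ext^n_A(B, Hom_k(B, V))`. -/
theorem hhPull_bijective (hφ : Function.Surjective φ)
    (hker : ∀ x, φ x = 0 ↔ x ∈ AeA e) (he : IsIdempotentElem e)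
    (hmul : Function.Bijective (mulMap k e he)) (n : ℕ) :
    Function.Bijective (hhPull φ : HH k B n → _) :=
  extTransfer_bijective (ModuleCat.restrictScalars.{u} (envMap φ)) (regMap φ)
    (regMap_comp_bijective φ hφ)
    (fun N => ⟨biCoind k B (rightRestrict N), biCoindUnit N, inferInstance,
      subsingleton_ext_hom_coind _ _,
      fun n => subsingleton_ext_of_iso (homResIso φ _ _)
        ((extHomEquiv k ((resFunctor φ).obj (ModuleCat.of B B))
          ((resFunctor φ).obj (coindObj k B (rightRestrict N)))
          (n + 1)).toEquiv.symm.subsingleton_congr.2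
            (subsingleton_ext_res_coind _ hφ hker he hmul _ n))⟩) _ n

/-- The change of rings isomorphism `HH^n(B) ≃ Ext^n_{A^e}(A, B)`. -/
def hhPullEquiv (hφ : Function.Surjective φ)
    (hker : ∀ x, φ x = 0 ↔ x ∈ AeA e) (he : IsIdempotentElem e)
    (hmul : Function.Bijective (mulMap k e he)) (n : ℕ) :
    HH k B n ≃ₗ[k] Abelian.Ext.{u} (regBimodule k A) (regRestrict φ) n :=
  LinearEquiv.ofBijective
    { extTransfer (ModuleCat.restrictScalars.{u} (envMap φ)) (regMap φ) (regBimodule k B) n with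
      map_smul' := extTransfer_smul k _ _ }
    (hhPull_bijective hφ hker he hmul n)

end HochschildRestriction

/-! ### The long exact sequence -/

noncomputable section LongExactSequence

variable (k : Type u) [Field k] {A : Type u} [Ring A] [Algebra k A] (e : A)

/-- The left module `D(eA)`. This is a definition rather than an abbreviation, so that `k` acts on
it through `A`, as on any object of the category of `A`-modules. -/
def dualObj : ModuleCat.{u} A := ModuleCat.of.{u} A (RightDual k A (rightPart e))

/-- The left module `Ae`, on which `k` acts through `A`, as for `dualObj`. -/
def leftObj : ModuleCat.{u} A := ModuleCat.of.{u} A (leftPart e)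

variable {k e}

/-- An element of `dualObj k e`, as a linear form on `eA`. -/
def toDual (f : dualObj k e) : Module.Dual k (rightPart e) := f

/-- A linear form on `eA`, as an element of `dualObj k e`. -/
def ofDual (f : Module.Dual k (rightPart e)) : dualObj k e := f

/-- An element of `leftObj e`, as an element of `Ae`. -/
def toLeft (x : leftObj e) : leftPart e := x

/-- An element of `Ae`, as an element of `leftObj e`. -/
def ofLeft (x : leftPart e) : leftObj e := x

theorem ofDual_smul (c : k) (f : Module.Dual k (rightPart e)) : ofDual (c • f) = c • ofDual f :=
  LinearMap.ext fun y =>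
    ((congrArg f (algebraMap_smul Aᵐᵒᵖ c y)).trans (LinearMap.map_smul f c y)).symm

theorem ofLeft_smul (c : k) (x : leftPart e) : ofLeft (c • x) = c • ofLeft x :=
  (algebraMap_smul A c x).symm

variable (k e)

/-- Linear maps from `D(eA)` to `Ae` are elements of the bimodule `Hom_k(D(eA), Ae)`, since the
action of `k` through `A` on `D(eA)` and `Ae` is the usual one. -/
def homDualEquiv :
    (Module.Dual k (rightPart e) →ₗ[k] leftPart e) ≃+ HomMod k (dualObj k e) (leftObj e) where
  toFun h := HomMod.of (k := k) (M := dualObj k e) (N := leftObj e)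
    { toFun f := ofLeft (h (toDual f))
      map_add' f g := map_add h (toDual f) (toDual g)
      map_smul' c f := by
        refine (congrArg (fun f => ofLeft (h f)) (ofDual_smul c (toDual f)).symm).trans ?_
        exact (congrArg ofLeft (LinearMap.map_smul h c (toDual f))).trans
          (ofLeft_smul c (h (toDual f))) }
  invFun h :=
    { toFun f := toLeft (h (ofDual f))
      map_add' f g := map_add h (ofDual f) (ofDual g)
      map_smul' c f := by
        refine (congrArg (fun f => toLeft (h f)) (ofDual_smul c f)).trans ?_
        exact (LinearMap.map_smul h.toLinearMap c (ofDual f)).trans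
          (ofLeft_smul c (toLeft (h (ofDual f)))).symm }
  left_inv _ := rfl
  right_inv _ := rfl
  map_add' _ _ := rfl

variable {k} in
/-- Multiplication by a central element, as an endomorphism of the regular bimodule. -/
def centerHom (I : Ideal A) : centerInter k I →ₗ[k] (regBimodule k A ⟶ regBimodule k A) where
  toFun z := ModuleCat.ofHom (X := regBimodule k A) (Y := regBimodule k A) (envLinearMap
    { toFun x := toReg k A (z.1 * ofReg k A x)
      map_zero' := mul_zero z.1
      map_add' x y := mul_add z.1 (ofReg k A x) (ofReg k A y) }
    fun a b x => by
      change z.1 * (a * (ofReg k A x * b.unop)) = a * (z.1 * ofReg k A x * b.unop)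
      rw [← mul_assoc, ← (Subalgebra.mem_center_iff (R := k)).1 z.2.1 a, mul_assoc, mul_assoc])
  map_add' z z' := by
    ext x
    exact add_mul z.1 z'.1 (ofReg k A x)
  map_smul' c z := by
    ext x
    change c • z.1 * ofReg k A x = algebraMap k A c * (z.1 * ofReg k A x * 1)
    rw [mul_one, Algebra.smul_def, mul_assoc]

variable {k} in
theorem centerHom_apply {I : Ideal A} (z : centerInter k I) :
    ofReg k A (centerHom I z (toReg k A 1)) = z.1 := mul_one z.1

variable {k} in
theorem hom_regBimodule_apply (g : regBimodule k A ⟶ regBimodule k A) (a : A) :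
    ofReg k A (g (toReg k A a)) = a * ofReg k A (g (toReg k A 1)) ∧
      ofReg k A (g (toReg k A a)) = ofReg k A (g (toReg k A 1)) * a := by
  constructor
  · rw [toReg_eq_left, map_smul, ofReg_tmul_smul, MulOpposite.unop_one, mul_one]
  · rw [toReg_eq_right, map_smul, ofReg_tmul_smul, MulOpposite.unop_op, one_mul]

variable {k e} {B : Type u} [Ring B] [Algebra k B] {φ : A →ₐ[k] B}

/-- The bimodule endomorphisms of `A` which vanish in `B` are the multiplications by central
elements of `AeA`. -/
theorem comp_regMap_eq_zero_iff (hker : ∀ x, φ x = 0 ↔ x ∈ AeA e)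
    (g : regBimodule k A ⟶ regBimodule k A) :
    g ≫ regMap φ = 0 ↔ g ∈ Set.range (centerHom (k := k) (AeA e)) := by
  constructor
  · intro h
    refine ⟨⟨ofReg k A (g (toReg k A 1)), (Subalgebra.mem_center_iff (R := k)).2 fun a =>
      (hom_regBimodule_apply g a).1.symm.trans (hom_regBimodule_apply g a).2,
      (hker _).1 (congrArg (fun t => t.hom (toReg k A 1)) h)⟩, ?_⟩
    ext a
    exact (hom_regBimodule_apply g (ofReg k A a)).2.symm
  · rintro ⟨z, rfl⟩
    ext a
    exact (hker _).2 ((AeA e).mul_mem_right _ z.2.2)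

variable (k e) [FiniteDimensional k A]

instance : FiniteDimensional k (rightPart e) :=
  FiniteDimensional.finiteDimensional_submodule ((rightPart e).restrictScalars k)

/-- The isomorphism `Ae ⊗ eA ≅ Hom_k(D(eA), Ae)`, `x ⊗ y ↦ (f ↦ f y • x)`. -/
def tensorEquivHom :
    (leftPart e) ⊗[k] (rightPart e) ≃+ HomMod k (dualObj k e) (leftObj e) :=
  (TensorProduct.comm k _ _ ≪≫ₗ
    TensorProduct.congr (Module.evalEquiv k (rightPart e)) (LinearEquiv.refl k _) ≪≫ₗ
    dualTensorHomEquiv k (Module.Dual k (rightPart e)) (leftPart e)).toAddEquiv.trans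
    (homDualEquiv k e)

theorem tensorEquivHom_tmul (x : leftPart e) (y : rightPart e) (f : dualObj k e) :
    tensorEquivHom k e (x ⊗ₜ y) f = ofLeft (toDual f y • x) := by
  change ofLeft (dualTensorHomEquiv k (Module.Dual k (rightPart e)) (leftPart e)
    (Module.evalEquiv k (rightPart e) y ⊗ₜ x) (toDual f)) = _
  simp

variable {e}

/-- The additive map underlying `mulHom`. -/
def mulAddHom (he : IsIdempotentElem e) :
    HomMod k (dualObj k e) (leftObj e) →+ regBimodule k A where
  toFun h := toReg k A (mulMap k e he ((tensorEquivHom k e).symm h))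
  map_zero' := congrArg Subtype.val ((congrArg _ (map_zero (tensorEquivHom k e).symm)).trans
    (map_zero (mulMap k e he)))
  map_add' h h' := congrArg Subtype.val ((congrArg _ (map_add (tensorEquivHom k e).symm h h')).trans
    (map_add (mulMap k e he) _ _))

theorem mulAddHom_apply (he : IsIdempotentElem e) (t : (leftPart e) ⊗[k] (rightPart e)) :
    mulAddHom k he (tensorEquivHom k e t) = toReg k A (mulMap k e he t) :=
  congrArg (fun t => toReg k A (mulMap k e he t)) ((tensorEquivHom k e).symm_apply_apply t)

theorem mulAddHom_smul (he : IsIdempotentElem e) (a : A) (b : Aᵐᵒᵖ)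
    (h : HomMod k (dualObj k e) (leftObj e)) :
    mulAddHom k he ((a ⊗ₜ[k] b : Env k A) • h) = (a ⊗ₜ[k] b : Env k A) • mulAddHom k he h := by
  obtain ⟨t, rfl⟩ := (tensorEquivHom k e).surjective h
  induction t using TensorProduct.induction_on with
  | zero => rw [map_zero, smul_zero, map_zero, smul_zero]
  | add s t hs ht => rw [map_add, smul_add, map_add, map_add, smul_add, hs, ht]
  | tmul x y =>
    have h1 : (a ⊗ₜ[k] b : Env k A) • tensorEquivHom k e (x ⊗ₜ y) =
        tensorEquivHom k e ((a • x) ⊗ₜ (b • y)) := HomMod.ext fun f => by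
      rw [HomMod.tmul_smul_apply, tensorEquivHom_tmul, tensorEquivHom_tmul]
      exact smul_comm a (toDual f (b • y)) x
    rw [h1, mulAddHom_apply, mulAddHom_apply]
    change a * x.1 * (y.1 * b.unop) = a * (x.1 * y.1 * b.unop)
    simp only [mul_assoc]

/-- The bimodule map `Hom_k(D(eA), Ae) ≅ Ae ⊗ eA → A` given by the multiplication. -/
def mulHom (he : IsIdempotentElem e) :
    (homFunctor k (dualObj k e)).obj (leftObj e) ⟶ regBimodule k A :=
  ModuleCat.ofHom (X := HomMod k (dualObj k e) (leftObj e)) (Y := regBimodule k A)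
    (envLinearMap (mulAddHom k he) (mulAddHom_smul k he))

variable {k}

/-- The sequence of bimodules `0 → Hom_k(D(eA), Ae) → A → B → 0`. -/
def mulShortComplex (hker : ∀ x, φ x = 0 ↔ x ∈ AeA e) (he : IsIdempotentElem e) :
    ShortComplex (ModuleCat.{u} (Env k A)) where
  f := mulHom k he
  g := regMap φ
  zero := by
    ext h
    exact (hker _).2 (mulMap k e he ((tensorEquivHom k e).symm (toHomMod h))).2

theorem mulShortComplex_shortExact (hφ : Function.Surjective φ)
    (hker : ∀ x, φ x = 0 ↔ x ∈ AeA e) (he : IsIdempotentElem e)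
    (hmul : Function.Bijective (mulMap k e he)) : (mulShortComplex hker he).ShortExact where
  exact := by
    rw [ShortComplex.moduleCat_exact_iff]
    intro x hx
    obtain ⟨t, ht⟩ := hmul.2 ⟨x, (hker _).1 hx⟩
    exact ⟨tensorEquivHom k e t, (mulAddHom_apply k he t).trans (congrArg Subtype.val ht)⟩
  mono_f := (ModuleCat.mono_iff_injective _).2 fun h h' hh =>
    (tensorEquivHom k e).symm.injective (hmul.1 (Subtype.ext hh))
  epi_g := (ModuleCat.epi_iff_surjective _).2 fun b => hφ b

/-- The long exact sequence, for any surjection `φ : A → B` with kernel `AeA`: it is the long exact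
sequence of `Ext_{A^e}(A, -)` associated with `mulShortComplex`. -/
theorem exists_longExactSequence (hφ : Function.Surjective φ)
    (hker : ∀ x, φ x = 0 ↔ x ∈ AeA e) (he : IsIdempotentElem e)
    (hmul : Function.Bijective (mulMap k e he)) :
    ∃ (ι : centerInter k (AeA e) →ₗ[k] HH k A 0)
      (α : ∀ p : ℕ, ExtDual k e (p + 1) →ₗ[k] HH k A (p + 1))
      (β : ∀ p : ℕ, HH k A p →ₗ[k] HH k B p)
      (δ : ∀ p : ℕ, HH k B p →ₗ[k] ExtDual k e (p + 1)),
      Function.Injective ι ∧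
      Function.Exact ι (β 0) ∧
      (∀ p, Function.Exact (β p) (δ p)) ∧
      (∀ p, Function.Exact (δ p) (α p)) ∧
      (∀ p, Function.Exact (α p) (β (p + 1))) ∧
      (∀ z, ofReg k A ((Abelian.Ext.addEquiv₀ (ι z)).hom (toReg k A 1)) = z.1) ∧
      (∀ p x, hhPull φ (β p x) = hhPush φ x) := by
  have hS := mulShortComplex_shortExact hφ hker he hmul
  let E (p : ℕ) := extHomEquiv k (dualObj k e) (leftObj e) p
  let P (p : ℕ) := hhPullEquiv hφ hker he hmul p
  let ι : centerInter k (AeA e) →ₗ[k] HH k A 0 :=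
    (Abelian.Ext.linearEquiv₀ (R := k)).symm.toLinearMap ∘ₗ centerHom (k := k) (AeA e)
  let a (p : ℕ) : Abelian.Ext.{u} (regBimodule k A)
      ((homFunctor k (dualObj k e)).obj (leftObj e)) p →ₗ[k] HH k A p :=
    (Abelian.Ext.mk₀ (mulHom k he)).postcompOfLinear k (regBimodule k A) (add_zero p)
  let b (p : ℕ) : HH k A p →ₗ[k] Abelian.Ext.{u} (regBimodule k A) (regRestrict φ) p :=
    (Abelian.Ext.mk₀ (regMap φ)).postcompOfLinear k (regBimodule k A) (add_zero p)
  let d (p : ℕ) : Abelian.Ext.{u} (regBimodule k A) (regRestrict φ) p →ₗ[k]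
      Abelian.Ext.{u} (regBimodule k A) ((homFunctor k (dualObj k e)).obj (leftObj e)) (p + 1) :=
    hS.extClass.postcompOfLinear k (regBimodule k A) rfl
  have hbd (p : ℕ) : Function.Exact (b p) (d p) := (ShortComplex.ab_exact_iff_function_exact _).mp
    (Abelian.Ext.covariant_sequence_exact₃' (regBimodule k A) hS p (p + 1) rfl)
  have hda (p : ℕ) : Function.Exact (d p) (a (p + 1)) :=
    (ShortComplex.ab_exact_iff_function_exact _).mp
      (Abelian.Ext.covariant_sequence_exact₁' (regBimodule k A) hS p (p + 1) rfl)
  have hab (p : ℕ) : Function.Exact (a p) (b p) := (ShortComplex.ab_exact_iff_function_exact _).mp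
    (Abelian.Ext.covariant_sequence_exact₂' (regBimodule k A) hS p)
  have hι (z) : Abelian.Ext.addEquiv₀ (ι z) = centerHom (k := k) (AeA e) z :=
    Abelian.Ext.addEquiv₀.apply_symm_apply _
  have hP (p : ℕ) (y) : (P p).symm y = 0 ↔ y = 0 := (P p).symm.map_eq_zero_iff
  have hE (p : ℕ) (y) : (E p).symm y = 0 ↔ y = 0 := (E p).symm.map_eq_zero_iff
  refine ⟨ι, fun p => a (p + 1) ∘ₗ (E (p + 1)).toLinearMap,
    fun p => (P p).symm.toLinearMap ∘ₗ b p,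
    fun p => (E (p + 1)).symm.toLinearMap ∘ₗ d p ∘ₗ (P p).toLinearMap,
    fun z z' h => Subtype.ext ?_, fun x => ?_, fun p y => ?_, fun p x => ?_, fun p x => ?_,
    fun z => ?_, fun p x => (P p).apply_symm_apply _⟩
  · rw [← centerHom_apply z, ← centerHom_apply z', ← hι, ← hι, h]
  · -- exactness at `HH^0(A)`, which is computed by bimodule endomorphisms of `A`
    obtain ⟨g, rfl⟩ := (Abelian.Ext.linearEquiv₀ (R := k)).symm.surjective x
    have h1 : b 0 ((Abelian.Ext.linearEquiv₀ (R := k)).symm g) =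
      Abelian.Ext.mk₀ (g ≫ regMap φ) := Abelian.Ext.mk₀_comp_mk₀ g (regMap φ)
    refine (hP 0 _).trans ?_
    rw [h1, Abelian.Ext.mk₀_eq_zero_iff, comp_regMap_eq_zero_iff hker]
    exact exists_congr fun z => (Abelian.Ext.linearEquiv₀ (R := k)).symm.injective.eq_iff.symm
  · refine (hE (p + 1) _).trans ((hbd p (P p y)).trans (exists_congr fun x => ?_))
    exact (P p).symm_apply_eq.symm
  · refine (hda p (E (p + 1) x)).trans ((P p).surjective.exists.trans (exists_congr fun y => ?_))
    exact (E (p + 1)).symm_apply_eq.symm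
  · exact (hP (p + 1) _).trans ((hab (p + 1) x).trans (E (p + 1)).surjective.exists)
  · rw [hι]
    exact centerHom_apply z

end LongExactSequence

end IdempotentQuotient

theorem mainTheorem9 {k : Type u} {A : Type u} [Field k] [Ring A] [Algebra k A]
    [FiniteDimensional k A] (e : A) (he : IsIdempotentElem e)
    (hmul : Function.Bijective (IdempotentQuotient.mulMap k e he)) :
    IdempotentQuotient.IsHomologicalIdeal (IdempotentQuotient.AeA e) ∧
    ∃ (ι : IdempotentQuotient.centerInter k (IdempotentQuotient.AeA e) →ₗ[k]
          IdempotentQuotient.HH k A 0)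
      (α : ∀ p : ℕ, IdempotentQuotient.ExtDual k e (p + 1) →ₗ[k]
          IdempotentQuotient.HH k A (p + 1))
      (β : ∀ p : ℕ, IdempotentQuotient.HH k A p →ₗ[k]
          IdempotentQuotient.HH k (A ⧸ IdempotentQuotient.AeA e) p)
      (δ : ∀ p : ℕ, IdempotentQuotient.HH k (A ⧸ IdempotentQuotient.AeA e) p →ₗ[k]
          IdempotentQuotient.ExtDual k e (p + 1)),
      -- exactness of the sequence
      Function.Injective ι ∧
      Function.Exact ι (β 0) ∧
      (∀ p, Function.Exact (β p) (δ p)) ∧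
      (∀ p, Function.Exact (δ p) (α p)) ∧
      (∀ p, Function.Exact (α p) (β (p + 1))) ∧
      -- `ι` is the inclusion of `Z(A) ∩ I` in the center `Hom_{A^e}(A, A) = HH^0(A)`
      (∀ z, IdempotentQuotient.ofReg k A
        ((Abelian.Ext.addEquiv₀ (ι z)).hom (IdempotentQuotient.toReg k A 1)) = z.1) ∧
      -- `β` is the map induced by the projection `A → A ⧸ AeA`
      (∀ p x, IdempotentQuotient.hhPull
          (Ideal.Quotient.mkₐ k (IdempotentQuotient.AeA e)) (β p x) =
        IdempotentQuotient.hhPush (Ideal.Quotient.mkₐ k (IdempotentQuotient.AeA e)) x) := by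
  have hφ : Function.Surjective (Ideal.Quotient.mkₐ k (IdempotentQuotient.AeA e)) :=
    Ideal.Quotient.mkₐ_surjective k _
  have hker (x : A) : Ideal.Quotient.mkₐ k (IdempotentQuotient.AeA e) x = 0 ↔
      x ∈ IdempotentQuotient.AeA e := Ideal.Quotient.eq_zero_iff_mem
  have hepi := IdempotentQuotient.isHomologicalEpi_toRingHom hφ hker he hmul
  exact ⟨hepi, IdempotentQuotient.exists_longExactSequence hφ hker he hmul⟩
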